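/- Let $n\ge 1$ and let $\mathcal S_n$ be the symmetric group on $[n]=\{1,\dots,n\}$, with product $(\pi\sigma)(i)=\pi(\sigma(i))$. For $\pi\in\mathcal S_n$ put $\mathrm{Des}(\pi)=\{i\in[n-1]:\pi(i)>\pi(i+1)\}$, and for $D\subseteq[n-1]$ let $$F_{n,D}=\sum_{\substack{i_1\le i_2\le\dots\le i_n\\ i_j<i_{j+1}\text{ if }j\in D}}x_{i_1}x_{i_2}\cdots x_{i_n}.$$ For $A\subseteq\mathcal S_n$ let $\mathcal Q(A)=\sum_{\pi\in A}F_{n,\mathrm{Des}(\pi)}$. The set $A$ is called fine if $\mathcal Q(A)$ is a symmetric function and all coefficients in its expansion in the basis of Schur functions $s_\lambda$, $\lambda\vdash n$, are nonnegative. A permutation $\pi\in\mathcal S_n$ is an arc permutation if, for every $1\le j\le n$, the set $\{\pi(1),\dots,\pi(j)\}$, reduced modulo $n$, is an interval in $\mathbb Z_n$ (the reduction modulo $n$ of an interval in $\mathbb Z$); it is left-unimodal if, for every $1\le j\le n$, the set $\{\pi(1),\dots,\pi(j)\}$ is an interval in $\mathbb Z$. Let $\mathcal A_n$ and $\mathcal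 L_n$ be the sets of arc permutations and of left-unimodal permutations in $\mathcal S_n$, and let $C_n$ be the cyclic subgroup generated by the $n$-cycle $(1,2,\dots,n)$. Then $\mathcal A_n$ is a fine set. Moreover, if $n\ge 2$, then $$\mathcal Q(\mathcal A_n)=s_n+s_{1^n}+\sum_{k=2}^{n-2}s_{n-k,2,1^{k-2}}+2\sum_{k=1}^{n-2}s_{n-k,1^k},$$ and $\mathcal A_n=\{\pi\sigma:\pi\in C_n,\ \sigma\in\mathcal L_n\}$, where every element of $\mathcal A_n$ equals $\pi\sigma$ for exactly two pairs $(\pi,\sigma)\in C_n\times\mathcal L_n$. -/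

import Mathlib

namespace ArcPerm

/-! Conventions.  `S_n` is `Equiv.Perm (Fin n)`; the letter at position `i + 1` of `π` is
`π i + 1 ∈ {1, …, n}`.  The set `[n-1]` is `Fin (n - 1)`, the term `j` standing for `j + 1`.
The product of permutations is composition, `(π * σ) i = π (σ i)`.  Power series are in the
countably many variables `x_0, x_1, x_2, …` with rational coefficients. -/

/-- The position `j` of `{1, …, n}`, for `j ∈ [n-1]`. -/
def pos {n : ℕ} (j : Fin (n - 1)) : Fin n := ⟨j, by omega⟩

/-- The position `j + 1` of `{1, …, n}`, for `j ∈ [n-1]`. -/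
def nextPos {n : ℕ} (j : Fin (n - 1)) : Fin n := ⟨j + 1, by omega⟩

/-- The descent set `{j ∈ [n-1] : π(j) > π(j+1)}`. -/
def descentSet {n : ℕ} (π : Equiv.Perm (Fin n)) : Finset (Fin (n - 1)) :=
  Finset.univ.filter fun j => π (nextPos j) < π (pos j)

/-- The fundamental quasisymmetric function `F_{n,D}`: the coefficient of a monomial is the number
of sequences `i_1 ≤ i_2 ≤ … ≤ i_n`, with `i_j < i_{j+1}` for `j ∈ D`, such that
`x_{i_1} x_{i_2} ⋯ x_{i_n}` is that monomial. -/
noncomputable def fundamental (n : ℕ) (D : Finset (Fin (n - 1))) : MvPowerSeries ℕ ℚ :=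
  fun m => (Nat.card {a : Fin n → ℕ // Monotone a ∧ (∀ j ∈ D, a (pos j) < a (nextPos j)) ∧
    ∑ i, Finsupp.single (a i) 1 = m} : ℚ)

/-- `Q(A) = ∑_{π ∈ A} F_{n, Des(π)}` for a set `A ⊆ S_n`. -/
noncomputable def quasisymmetricFunction {n : ℕ} (A : Finset (Equiv.Perm (Fin n))) :
    MvPowerSeries ℕ ℚ :=
  ∑ π ∈ A, fundamental n (descentSet π)

/-- The exponent vector of the monomial `x^T` of a semistandard Young tableau `T`. -/
noncomputable def weight {μ : YoungDiagram} (T : SemistandardYoungTableau μ) : ℕ →₀ ℕ :=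
  ∑ c ∈ μ.cells, Finsupp.single (T c.1 c.2) 1

/-- The Young diagram whose row lengths are the elements of `l` in weakly decreasing order. -/
def diagram (l : Multiset ℕ) : YoungDiagram :=
  YoungDiagram.ofRowLens (l.sort (· ≥ ·)) (l.pairwise_sort (· ≥ ·)).sortedGE

/-- The Schur function `s_l = ∑_T x^T`, over all semistandard Young tableaux `T` whose shape is the
partition with multiset of parts `l`. -/
noncomputable def schur (l : Multiset ℕ) : MvPowerSeries ℕ ℚ :=
  fun m => (Nat.card {T : SemistandardYoungTableau (diagram l) // weight T = m} : ℚ)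

/-- `f` is a homogeneous symmetric function of degree `n`, that is, `f ∈ Λ^n`. -/
def IsSymmetricFunction (n : ℕ) (f : MvPowerSeries ℕ ℚ) : Prop :=
  (∀ m : ℕ →₀ ℕ, MvPowerSeries.coeff m f ≠ 0 → m.degree = n) ∧
  ∀ (e : Equiv.Perm ℕ) (m : ℕ →₀ ℕ),
    MvPowerSeries.coeff (m.mapDomain e) f = MvPowerSeries.coeff m f

/-- `f` is a linear combination of the Schur functions indexed by the partitions of `n`, with
nonnegative coefficients. -/
def IsSchurPositive (n : ℕ) (f : MvPowerSeries ℕ ℚ) : Prop :=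
  ∃ c : n.Partition → ℚ, (∀ p, 0 ≤ c p) ∧ f = ∑ p, c p • schur p.parts

/-- A set of permutations is fine if its quasisymmetric function is symmetric and
Schur-positive. -/
def IsFine {n : ℕ} (A : Finset (Equiv.Perm (Fin n))) : Prop :=
  IsSymmetricFunction n (quasisymmetricFunction A) ∧ IsSchurPositive n (quasisymmetricFunction A)

/-- An interval in `ℤ/n`: the reduction modulo `n` of an interval in `ℤ`. -/
def IsCyclicInterval (n : ℕ) (S : Set (ZMod n)) : Prop :=
  ∃ a b : ℤ, S = (fun z : ℤ => (z : ZMod n)) '' Set.Icc a b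

/-- For every `1 ≤ j ≤ n`, the first `j` letters of `π` form an interval in `ℤ/n`. -/
def IsArc {n : ℕ} (π : Equiv.Perm (Fin n)) : Prop :=
  ∀ j : ℕ, 1 ≤ j → j ≤ n →
    IsCyclicInterval n ((fun i : Fin n => (((π i : ℕ) + 1 : ℕ) : ZMod n)) '' {i | (i : ℕ) < j})

/-- Every prefix of `π` forms an interval in `ℤ`. -/
def IsLeftUnimodal {n : ℕ} (π : Equiv.Perm (Fin n)) : Prop :=
  ∀ j : ℕ, 1 ≤ j → j ≤ n →
    ∃ a b : ℤ, (fun i : Fin n => (π i : ℤ) + 1) '' {i | (i : ℕ) < j} = Set.Icc a b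

open Classical in
/-- The set `A_n` of arc permutations in `S_n`. -/
noncomputable def arcPerms (n : ℕ) : Finset (Equiv.Perm (Fin n)) :=
  Finset.univ.filter IsArc

open Classical in
/-- The set `L_n` of left-unimodal permutations in `S_n`. -/
noncomputable def leftUnimodalPerms (n : ℕ) : Finset (Equiv.Perm (Fin n)) :=
  Finset.univ.filter IsLeftUnimodal

open Classical in
/-- The cyclic subgroup `C_n` of `S_n` generated by the cycle `(1, 2, …, n)`. -/
noncomputable def cyclicPerms (n : ℕ) : Finset (Equiv.Perm (Fin n)) :=
  Finset.univ.filter fun π => π ∈ Subgroup.zpowers (finRotate n)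

/-- The multiset product `AB` of `A, B ⊆ S_n`: all `π * σ` with `π ∈ A` and `σ ∈ B`, counted with
multiplicity. -/
def multisetProduct {n : ℕ} (A B : Finset (Equiv.Perm (Fin n))) :
    Multiset (Equiv.Perm (Fin n)) :=
  (A ×ˢ B).val.map fun p => p.1 * p.2

end ArcPerm

/-! For n ≥ 2 both sides of the expansion have the coefficient 2^(v-2) (v + s) at every monomial of
degree n, where v is the number of variables that occur in it and s the number of those with
exponent at least 2. Both numbers are invariant under permuting the variables, which gives symmetry;
Schur positivity is read off from the expansion.

Quasisymmetric side. A monomial is x_{a_0} ⋯ x_{a_{n-1}} for exactly one weakly increasing a, and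
F_{n,D} has coefficient 1 there if a increases strictly at all positions of D, and 0 otherwise. So
the coefficient counts the arc permutations all of whose descents lie at strict ascents of a. A
permutation is an arc permutation iff each letter after the first is a cyclic neighbour of an
earlier one (`isArc_iff`). Hence deletion of the first letter preserves the property, and a letter
may be put in front iff it becomes a cyclic neighbour of the letter that follows it
(`isArc_consPerm_iff`). There are in general two such letters, one creating an ascent and one a
descent; if the following letter is smallest or largest, wrapping around the cycle gives one more.
The resulting linear recursion couples the total count with the counts by extreme first letter and
is solved in `arcCount_formula`.

Schur side. A tableau of hook shape is determined by its leg, an arbitrary set of non-minimal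
variables, so hooks contribute binomial coefficients. A tableau of shape (p, 2, 1^(q-1)) is
determined by its leg and its entry in cell (1, 1). Taken over all leg lengths at once, these pairs
are counted by induction on the largest variable (`card_legPairs`), and a binomial sum finishes the
computation.

Product. For n ≥ 2, left-unimodal permutations are the arc permutations whose last letter is 1 or n
(`isLeftUnimodal_iff`). Rotating the values preserves arc permutations, and exactly two rotations
bring a given last letter to an extreme value. -/

namespace ArcPerm

/-! ### Arc permutations through adjacency on the cycle -/

/-- Two letters of `{0, …, n - 1}` that are neighbours on the cycle of length `n`. -/
def CyclicAdj (n x y : ℕ) : Prop :=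
  x + 1 = y ∨ y + 1 = x ∨ (x = 0 ∧ y + 1 = n) ∨ (y = 0 ∧ x + 1 = n)

theorem zmod_eq_add_one_iff {n x y : ℕ} (hx : x < n) (hy : y < n) :
    (y : ZMod n) = x + 1 ↔ (x + 1 = y ∨ (y = 0 ∧ x + 1 = n)) := by
  have h : ((y : ZMod n) = x + 1) ↔ ((y : ZMod n) = ((x + 1 : ℕ) : ZMod n)) := by push_cast; rfl
  rw [h, ZMod.natCast_eq_natCast_iff, Nat.ModEq, Nat.mod_eq_of_lt hy]
  rcases Nat.lt_or_ge (x + 1) n with h1 | h1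
  · rw [Nat.mod_eq_of_lt h1]; omega
  · have : x + 1 = n := by omega
    rw [this, Nat.mod_self]; omega

theorem cyclicAdj_iff {n x y : ℕ} (hx : x < n) (hy : y < n) :
    CyclicAdj n x y ↔ ((y : ZMod n) = x + 1 ∨ (x : ZMod n) = y + 1) := by
  rw [zmod_eq_add_one_iff hx hy, zmod_eq_add_one_iff hy hx]
  unfold CyclicAdj
  tauto

theorem natCast_zmod_inj {n x y : ℕ} (hx : x < n) (hy : y < n)
    (h : (x : ZMod n) = y) : x = y := by
  rwa [ZMod.natCast_eq_natCast_iff, Nat.ModEq, Nat.mod_eq_of_lt hy, Nat.mod_eq_of_lt hx] at h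

/-- A cyclic interval grows by one letter only at one of its ends, that is, by a neighbour of a
letter already present. This local criterion replaces intervals in all that follows. -/
theorem isArc_iff {n : ℕ} (π : Equiv.Perm (Fin n)) :
    IsArc π ↔ ∀ j : Fin n, 0 < (j : ℕ) → ∃ i < j, CyclicAdj n (π i) (π j) := by
  constructor
  · intro h j hj
    obtain ⟨a, b, hab⟩ := h (j + 1) (by omega) (by omega)
    have hmem : ∀ i : Fin n, i ≤ j → ∃ z ∈ Set.Icc a b, (z : ZMod n) = (π i : ℕ) + 1 := by
      intro i hi
      have : (((π i : ℕ) + 1 : ℕ) : ZMod n) ∈ (fun z : ℤ => (z : ZMod n)) '' Set.Icc a b := by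
        rw [← hab]; exact ⟨i, by simpa [Nat.lt_succ_iff] using hi, rfl⟩
      obtain ⟨z, hz, hz'⟩ := this
      exact ⟨z, hz, by simpa using hz'⟩
    have hback : ∀ z ∈ Set.Icc a b, ∃ i ≤ j, (z : ZMod n) = (π i : ℕ) + 1 := by
      intro z hz
      have : (z : ZMod n) ∈ (fun z : ℤ => (z : ZMod n)) '' Set.Icc a b := ⟨z, hz, rfl⟩
      rw [← hab] at this
      obtain ⟨i, hi, hi'⟩ := this
      exact ⟨i, by simpa [Nat.lt_succ_iff] using hi, by simpa using hi'.symm⟩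
    have hinj : ∀ i i' : Fin n, ((π i : ℕ) : ZMod n) = (π i' : ℕ) → i = i' := by
      intro i i' hi
      exact π.injective (Fin.ext (natCast_zmod_inj (π i).2 (π i').2 hi))
    have h1 : (1 : ZMod n) ≠ 0 := by
      have : Fact (1 < n) := ⟨by omega⟩
      exact one_ne_zero
    obtain ⟨z, hz, hzj⟩ := hmem j le_rfl
    have hlt : ∀ i ≤ j, CyclicAdj n (π i) (π j) → ∃ i < j, CyclicAdj n (π i) (π j) := by
      intro i hi hadj
      refine ⟨i, lt_of_le_of_ne hi ?_, hadj⟩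
      rintro rfl
      rw [cyclicAdj_iff (π i).2 (π i).2] at hadj
      simp [h1] at hadj
    by_cases hza : a < z
    · obtain ⟨i, hi, hi'⟩ := hback (z - 1) ⟨by omega, by have := hz.2; omega⟩
      refine hlt i hi ((cyclicAdj_iff (π i).2 (π j).2).2 (Or.inl ?_))
      push_cast at hi'
      rw [hzj] at hi'
      simpa using hi'
    · by_cases hzb : z < b
      · obtain ⟨i, hi, hi'⟩ := hback (z + 1) ⟨by have := hz.1; omega, by omega⟩
        refine hlt i hi ((cyclicAdj_iff (π i).2 (π j).2).2 (Or.inr ?_))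
        push_cast at hi'
        rw [hzj] at hi'
        exact (add_right_cancel hi').symm
      -- Here the interval is a single point, so the first letter would coincide with letter j,
      -- although j > 0.
      · exfalso
        obtain ⟨y, hy, hy'⟩ := hmem ⟨0, by omega⟩ (by simp [Fin.le_def])
        have hyz : y = z := by
          have := hz.1; have := hz.2; have := hy.1; have := hy.2; omega
        rw [hyz, hzj] at hy'
        have := hinj _ _ (add_right_cancel hy')
        rw [this] at hj
        simp at hj
  · intro h j hj1 hjn
    induction j, hj1 using Nat.le_induction with
    | base =>
      refine ⟨((π ⟨0, by omega⟩ : ℕ) + 1 : ℕ), ((π ⟨0, by omega⟩ : ℕ) + 1 : ℕ), ?_⟩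
      have : {i : Fin n | (i : ℕ) < 1} = {⟨0, by omega⟩} := by
        ext i; simp [Fin.ext_iff]
      rw [this, Set.Icc_self, Set.image_singleton, Set.image_singleton]
      push_cast; rfl
    | succ j hj1 ih =>
      obtain ⟨a, b, hab⟩ := ih (by omega)
      obtain ⟨i, hij, hadj⟩ := h ⟨j, by omega⟩ (by simp; omega)
      have hset : {i : Fin n | (i : ℕ) < j + 1} = insert ⟨j, by omega⟩ {i : Fin n | (i : ℕ) < j} := by
        ext i; simp [Fin.ext_iff]; omega
      have hz : (((π i : ℕ) + 1 : ℕ) : ZMod n) ∈ (fun z : ℤ => (z : ZMod n)) '' Set.Icc a b := by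
        rw [← hab]; exact ⟨i, hij, rfl⟩
      obtain ⟨z, ⟨hza, hzb⟩, hzi⟩ := hz
      rw [cyclicAdj_iff (π _).2 (π _).2] at hadj
      simp only at hzi
      push_cast at hzi
      rw [hset, Set.image_insert_eq, hab]
      rcases hadj with hadj | hadj
      · have hj' : (((π ⟨j, by omega⟩ : ℕ) + 1 : ℕ) : ZMod n) = ((z + 1 : ℤ) : ZMod n) := by
          push_cast; rw [hadj, hzi]
        rw [hj']
        rcases eq_or_lt_of_le hzb with rfl | hlt
        · refine ⟨a, z + 1, ?_⟩
          rw [← Set.image_insert_eq (f := fun z : ℤ => (z : ZMod n))]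
          congr 1
          ext y; simp; omega
        -- The successor of a non-final point of the interval already lies in it, so the interval
        -- does not change.
        · refine ⟨a, b, Set.insert_eq_of_mem ⟨z + 1, ⟨by omega, by omega⟩, rfl⟩⟩
      · have hj' : (((π ⟨j, by omega⟩ : ℕ) + 1 : ℕ) : ZMod n) = ((z - 1 : ℤ) : ZMod n) := by
          push_cast; rw [hzi, hadj]; ring
        rw [hj']
        rcases eq_or_lt_of_le hza with rfl | hlt
        · refine ⟨a - 1, b, ?_⟩
          rw [← Set.image_insert_eq (f := fun z : ℤ => (z : ZMod n))]
          congr 1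
          ext y; simp; omega
        · refine ⟨a, b, Set.insert_eq_of_mem ⟨z - 1, ⟨by omega, by omega⟩, rfl⟩⟩

/-! ### Building arc permutations by prefixing a letter -/

/-- Prefix the letter `v` to a permutation, keeping the relative order of the other letters. -/
def consPerm {n : ℕ} (v : Fin (n + 1)) (π : Equiv.Perm (Fin n)) : Equiv.Perm (Fin (n + 1)) :=
  (finSuccEquiv n).trans ((Equiv.optionCongr π).trans (finSuccEquiv' v).symm)

@[simp] theorem consPerm_zero {n : ℕ} (v : Fin (n + 1)) (π : Equiv.Perm (Fin n)) :
    consPerm v π 0 = v := by simp [consPerm]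

@[simp] theorem consPerm_succ {n : ℕ} (v : Fin (n + 1)) (π : Equiv.Perm (Fin n)) (i : Fin n) :
    consPerm v π i.succ = v.succAbove (π i) := by simp [consPerm]

theorem consPerm_bijective (n : ℕ) :
    Function.Bijective fun p : Fin (n + 1) × Equiv.Perm (Fin n) => consPerm p.1 p.2 := by
  rw [Fintype.bijective_iff_injective_and_card]
  constructor
  · rintro ⟨v, π⟩ ⟨v', π'⟩ h
    simp only at h
    have h0 : v = v' := by simpa using congrArg (fun σ => σ 0) h
    subst h0
    have : π = π' := by
      ext i
      have := congrArg (fun σ => σ i.succ) h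
      simp only [consPerm_succ] at this
      rw [Fin.succAbove_right_injective this]
    rw [this]
  · simp [Fintype.card_perm, Nat.factorial_succ]

theorem val_succAbove {n : ℕ} (v : Fin (n + 1)) (x : Fin n) :
    ((x : ℕ) < v ∧ (v.succAbove x : ℕ) = x) ∨ ((v : ℕ) ≤ x ∧ (v.succAbove x : ℕ) = x + 1) := by
  rw [Fin.succAbove]
  split_ifs with h <;> simp_all [Fin.lt_def]

/-- Deleting v from the cycle keeps the adjacencies among the other letters and creates one more,
between the two neighbours of v. Since the second letter is one of these neighbours, a later letter
supported only by v becomes supported by the second letter. -/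
theorem isArc_consPerm_iff {n : ℕ} (v : Fin (n + 2)) (π : Equiv.Perm (Fin (n + 1))) :
    IsArc (consPerm v π) ↔
      IsArc π ∧ CyclicAdj (n + 2) v (v.succAbove (π 0)) := by
  rw [isArc_iff, isArc_iff]
  have hv := v.2
  constructor
  · intro h
    have hadj : CyclicAdj (n + 2) v (v.succAbove (π 0)) := by
      obtain ⟨i, hi, hadj⟩ := h (Fin.succ 0) (by simp)
      have : i = 0 := by
        rw [Fin.lt_def] at hi; ext; simp at hi; simp [hi]
      subst this
      rwa [consPerm_zero, consPerm_succ] at hadj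
    refine ⟨?_, hadj⟩
    intro j hj
    obtain ⟨i, hi, hadj'⟩ := h j.succ (by simp)
    have hne : (π 0 : ℕ) ≠ π j := by
      intro h; have := π.injective (Fin.ext h); subst this; simp at hj
    have h0 := (π 0).2
    have hj' := (π j).2
    induction i using Fin.cases with
    | zero =>
      refine ⟨0, by rw [Fin.lt_def]; simpa using hj, ?_⟩
      rw [consPerm_zero, consPerm_succ] at hadj'
      have := val_succAbove v (π 0)
      have := val_succAbove v (π j)
      unfold CyclicAdj at *
      omega
    | succ i =>
      refine ⟨i, by simpa using hi, ?_⟩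
      have hi' := (π i).2
      rw [consPerm_succ, consPerm_succ] at hadj'
      have := val_succAbove v (π i)
      have := val_succAbove v (π j)
      have hij : (π i : ℕ) ≠ π j := by
        intro h; have := π.injective (Fin.ext h); subst this; simp at hi
      unfold CyclicAdj at *
      omega
  · rintro ⟨h, hadj⟩ j hj
    induction j using Fin.cases with
    | zero => simp at hj
    | succ j =>
      by_cases hj0 : j = 0
      · subst hj0
        exact ⟨0, by simp, by rw [consPerm_zero, consPerm_succ]; exact hadj⟩
      · obtain ⟨i, hi, hadj'⟩ := h j (by
          rw [← Fin.val_zero (n + 1)]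
          exact Nat.pos_of_ne_zero fun h => hj0 (Fin.ext h))
        have hi' := (π i).2
        have hj' := (π j).2
        have hne : (π i : ℕ) ≠ π j := by
          intro h; have := π.injective (Fin.ext h); subst this; simp at hi
        -- An adjacency in the shorter cycle is lost only if v separates the two letters, and then
        -- both are adjacent to v itself.
        by_cases hc : CyclicAdj (n + 2) v (v.succAbove (π j))
        · exact ⟨0, by simp, by simpa using hc⟩
        · refine ⟨i.succ, by simpa using hi, ?_⟩
          rw [consPerm_succ, consPerm_succ]
          have := val_succAbove v (π i)
          have := val_succAbove v (π j)
          have := val_succAbove v (π 0)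
          unfold CyclicAdj at *
          omega

/-- Every descent of `π` lies in `S`. -/
def DescentsIn {n : ℕ} (S : ℕ → Prop) (π : Equiv.Perm (Fin n)) : Prop :=
  ∀ (j : ℕ) (h : j + 1 < n), π ⟨j + 1, h⟩ < π ⟨j, by omega⟩ → S j

theorem descentsIn_consPerm_iff {n : ℕ} (S : ℕ → Prop) (v : Fin (n + 2))
    (π : Equiv.Perm (Fin (n + 1))) :
    DescentsIn S (consPerm v π) ↔
      (((π 0 : ℕ) < v → S 0) ∧ DescentsIn (fun j => S (j + 1)) π) := by
  have h0 : ∀ h, (⟨0, h⟩ : Fin (n + 2)) = 0 := fun _ => rfl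
  have hs : ∀ j h, (⟨j + 1, h⟩ : Fin (n + 2)) = Fin.succ ⟨j, by omega⟩ := fun _ _ => rfl
  have hlt : v.succAbove (π 0) < v ↔ (π 0 : ℕ) < v := by
    have := val_succAbove v (π 0)
    rw [Fin.lt_def]; omega
  constructor
  · intro h
    refine ⟨fun h1 => h 0 (by omega) ?_, fun j hj h1 => h (j + 1) (by omega) ?_⟩
    · rw [hs, h0, consPerm_succ, consPerm_zero]
      exact hlt.2 h1
    · rw [hs, hs, consPerm_succ, consPerm_succ]
      exact Fin.strictMono_succAbove v h1
  · rintro ⟨h1, h2⟩ j hj h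
    cases j with
    | zero =>
      rw [hs, h0, consPerm_succ, consPerm_zero] at h
      exact h1 (hlt.1 h)
    | succ j =>
      rw [hs, hs, consPerm_succ, consPerm_succ] at h
      exact h2 j (by omega) ((Fin.strictMono_succAbove v).lt_iff_lt.1 h)

open Classical in
/-- The arc permutations of `n + 1` letters with all descents in `S`. -/
noncomputable def arcsWithin (n : ℕ) (S : ℕ → Prop) : Finset (Equiv.Perm (Fin (n + 1))) :=
  Finset.univ.filter fun π => IsArc π ∧ DescentsIn S π

-- Sorts the permutations by what remains after the first letter is deleted; the predicate `P` will
-- be trivial or will prescribe an extreme first letter. The shift of `S` reflects the loss of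
-- position 0.
open Classical in
theorem card_arcsWithin_succ_filter (n : ℕ) (S : ℕ → Prop) (P : Fin (n + 2) → Prop)
    [DecidablePred P] :
    ((arcsWithin (n + 1) S).filter fun π => P (π 0)).card =
      ∑ π ∈ arcsWithin n (fun j => S (j + 1)),
        (Finset.univ.filter fun v : Fin (n + 2) =>
          P v ∧ CyclicAdj (n + 2) v (v.succAbove (π 0)) ∧ ((π 0 : ℕ) < v → S 0)).card := by
  have h : ((arcsWithin (n + 1) S).filter fun π => P (π 0)).card =
      (Finset.univ.filter fun p : Fin (n + 2) × Equiv.Perm (Fin (n + 1)) =>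
        (IsArc p.2 ∧ DescentsIn (fun j => S (j + 1)) p.2) ∧
        (P p.1 ∧ CyclicAdj (n + 2) p.1 (p.1.succAbove (p.2 0)) ∧ ((p.2 0 : ℕ) < p.1 → S 0))).card := by
    symm
    refine Finset.card_bijective _ (consPerm_bijective (n + 1)) ?_
    intro p
    simp only [arcsWithin, Finset.mem_filter, Finset.mem_univ, true_and, isArc_consPerm_iff,
      descentsIn_consPerm_iff, consPerm_zero]
    tauto
  rw [h, Finset.card_filter, Fintype.sum_prod_type_right, arcsWithin, Finset.sum_filter]
  refine Finset.sum_congr rfl fun π _ => ?_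
  split_ifs with hπ
  · rw [Finset.card_filter]
    exact Finset.sum_congr rfl fun v _ => if_congr (by simp [hπ]) rfl rfl
  · exact Finset.sum_eq_zero fun v _ => if_neg (by tauto)

theorem cyclicAdj_succAbove_iff {n : ℕ} (v : Fin (n + 2)) (w : Fin (n + 1)) :
    CyclicAdj (n + 2) v (v.succAbove w) ↔
      ((v : ℕ) = w ∨ (v : ℕ) = w + 1 ∨ ((w : ℕ) = 0 ∧ (v : ℕ) = n + 1) ∨
        ((w : ℕ) = n ∧ (v : ℕ) = 0)) := by
  have := val_succAbove v w
  have := v.2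
  have := w.2
  unfold CyclicAdj
  omega

-- In standardized values the admissible v are w (ascent) and w + 1 (descent), and by wrapping
-- around 0 if w is largest (ascent) and n + 1 if w is smallest (descent). As `1 ≤ n`, w is not both
-- smallest and largest.
open Classical in
theorem card_insertions {n : ℕ} (hn : 1 ≤ n) (w : Fin (n + 1)) (s : Prop) :
    (Finset.univ.filter fun v : Fin (n + 2) =>
      True ∧ CyclicAdj (n + 2) v (v.succAbove w) ∧ ((w : ℕ) < v → s)).card =
      (1 + if w = Fin.last n then 1 else 0) + if s then (1 + if w = 0 then 1 else 0) else 0 := by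
  have hw := w.2
  have key : ∀ t : Finset (Fin (n + 2)),
      (∀ v, v ∈ t ↔ ((v : ℕ) = w ∨ (v : ℕ) = w + 1 ∨ ((w : ℕ) = 0 ∧ (v : ℕ) = n + 1) ∨
        ((w : ℕ) = n ∧ (v : ℕ) = 0)) ∧ ((w : ℕ) < v → s)) →
      (Finset.univ.filter fun v : Fin (n + 2) =>
        True ∧ CyclicAdj (n + 2) v (v.succAbove w) ∧ ((w : ℕ) < v → s)) = t := by
    intro t ht
    ext v
    simp only [cyclicAdj_succAbove_iff, Finset.mem_filter, Finset.mem_univ, true_and, ht]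
  by_cases h0 : (w : ℕ) = 0
  · have hl : (w : ℕ) ≠ n := by omega
    rw [if_neg (show w ≠ Fin.last n from fun h => hl (by rw [h]; rfl)), if_pos (Fin.ext h0)]
    by_cases hs : s
    · rw [key {w.castSucc, w.succ, Fin.last (n + 1)}]
      · rw [Finset.card_insert_of_notMem, Finset.card_pair] <;> simp [Fin.ext_iff, hs, h0] <;> omega
      · intro v
        simp only [Finset.mem_insert, Finset.mem_singleton, Fin.ext_iff, Fin.val_castSucc,
          Fin.val_succ, Fin.val_last, hs, implies_true, and_true]
        omega
    · rw [key {w.castSucc}]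
      · simp [hs]
      · intro v
        simp only [Finset.mem_singleton, Fin.ext_iff, Fin.val_castSucc, hs, imp_false]
        omega
  · rw [if_neg (show w ≠ 0 from fun h => h0 (by rw [h]; rfl))]
    by_cases hl : (w : ℕ) = n
    · rw [if_pos (Fin.ext hl)]
      by_cases hs : s
      · rw [key {w.castSucc, w.succ, 0}]
        · rw [Finset.card_insert_of_notMem, Finset.card_pair] <;> simp [Fin.ext_iff, hs, hl] <;>
            omega
        · intro v
          simp only [Finset.mem_insert, Finset.mem_singleton, Fin.ext_iff, Fin.val_castSucc,
            Fin.val_succ, Fin.val_zero, hs, implies_true, and_true]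
          omega
      · rw [key {w.castSucc, 0}]
        · rw [Finset.card_pair] <;> simp [Fin.ext_iff, hs, hl] ; omega
        · intro v
          simp only [Finset.mem_insert, Finset.mem_singleton, Fin.ext_iff, Fin.val_castSucc,
            Fin.val_zero, hs, imp_false]
          omega
    · rw [if_neg (show w ≠ Fin.last n from fun h => hl (by rw [h]; rfl))]
      by_cases hs : s
      · rw [key {w.castSucc, w.succ}]
        · rw [Finset.card_pair] <;> simp [Fin.ext_iff, hs]
        · intro v
          simp only [Finset.mem_insert, Finset.mem_singleton, Fin.ext_iff, Fin.val_castSucc,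
            Fin.val_succ, hs, implies_true, and_true]
          omega
      · rw [key {w.castSucc}]
        · simp [hs]
        · intro v
          simp only [Finset.mem_singleton, Fin.ext_iff, Fin.val_castSucc, hs, imp_false]
          omega

theorem card_filter_fin_eq {n : ℕ} (a : Fin n) (Q : Fin n → Prop)
    [DecidablePred fun v => v = a ∧ Q v] [Decidable (Q a)] :
    (Finset.univ.filter fun v : Fin n => v = a ∧ Q v).card = if Q a then 1 else 0 := by
  have : (Finset.univ.filter fun v : Fin n => v = a ∧ Q v) = if Q a then {a} else ∅ := by
    ext v
    split_ifs with h <;> simp <;> rintro rfl <;> exact h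
  rw [this]
  split_ifs <;> simp

/-! ### Recursion for the number of arc permutations with prescribed descents -/

/-- The number of arc permutations of `n + 1` letters with all descents in `S`. -/
noncomputable def arcCount (n : ℕ) (S : ℕ → Prop) : ℕ := (arcsWithin n S).card

/-- The number of those that begin with the smallest letter. -/
noncomputable def botCount (n : ℕ) (S : ℕ → Prop) : ℕ :=
  ((arcsWithin n S).filter fun π => π 0 = 0).card

/-- The number of those that begin with the largest letter. -/
noncomputable def topCount (n : ℕ) (S : ℕ → Prop) : ℕ :=
  ((arcsWithin n S).filter fun π => π 0 = Fin.last n).card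

open Classical in
theorem arcCount_succ {n : ℕ} (hn : 1 ≤ n) (S : ℕ → Prop) :
    arcCount (n + 1) S = arcCount n (fun j => S (j + 1)) + topCount n (fun j => S (j + 1)) +
      if S 0 then arcCount n (fun j => S (j + 1)) + botCount n (fun j => S (j + 1)) else 0 := by
  have h := card_arcsWithin_succ_filter n S (fun _ => True)
  rw [Finset.filter_true] at h
  rw [arcCount, h]
  simp only [card_insertions hn]
  rw [arcCount, topCount, botCount, Finset.card_filter, Finset.card_filter]
  split_ifs <;> simp [Finset.sum_add_distrib]

-- The smallest letter may precede only a smallest or a largest remaining letter, always with an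
-- ascent. For the largest letter the same two cases occur, always with a descent.
open Classical in
theorem botCount_succ {n : ℕ} (hn : 1 ≤ n) (S : ℕ → Prop) :
    botCount (n + 1) S = botCount n (fun j => S (j + 1)) + topCount n (fun j => S (j + 1)) := by
  rw [botCount, card_arcsWithin_succ_filter n S (fun v => v = 0), botCount, topCount,
    Finset.card_filter, Finset.card_filter, ← Finset.sum_add_distrib]
  refine Finset.sum_congr rfl fun π _ => ?_
  rw [card_filter_fin_eq]
  simp only [cyclicAdj_succAbove_iff]
  simp only [Fin.ext_iff, Fin.val_zero, Fin.val_last, Nat.not_lt_zero, false_implies, and_true]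
  rcases Nat.eq_zero_or_pos (π 0 : ℕ) with h | h
  · simp only [h, true_or, if_true]
    rw [if_neg (by omega)]
  · rw [if_neg (show ¬(π 0 : ℕ) = 0 by omega), zero_add]
    exact if_congr (by omega) rfl rfl

open Classical in
theorem topCount_succ {n : ℕ} (hn : 1 ≤ n) (S : ℕ → Prop) :
    topCount (n + 1) S =
      if S 0 then botCount n (fun j => S (j + 1)) + topCount n (fun j => S (j + 1)) else 0 := by
  rw [topCount, card_arcsWithin_succ_filter n S (fun v => v = Fin.last (n + 1)), botCount, topCount,
    Finset.card_filter, Finset.card_filter, ← Finset.sum_add_distrib]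
  by_cases hS : S 0
  · rw [if_pos hS]
    refine Finset.sum_congr rfl fun π _ => ?_
    rw [card_filter_fin_eq]
    have := (π 0).2
    simp only [cyclicAdj_succAbove_iff]
    simp only [Fin.ext_iff, Fin.val_zero, Fin.val_last, hS, implies_true, and_true]
    split_ifs <;> omega
  · rw [if_neg hS]
    refine Finset.sum_eq_zero fun π _ => ?_
    rw [card_filter_fin_eq, if_neg]
    have := (π 0).2
    simp only [cyclicAdj_succAbove_iff]
    simp only [Fin.val_last, hS, imp_false]
    omega

theorem isArc_fin_one (π : Equiv.Perm (Fin 1)) : IsArc π := by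
  rw [isArc_iff]
  intro j hj
  omega

theorem descentsIn_fin_one (S : ℕ → Prop) (π : Equiv.Perm (Fin 1)) : DescentsIn S π := by
  intro j hj
  omega

open Classical in
theorem card_arcsWithin_one_filter (S : ℕ → Prop) (P : Fin 2 → Prop) [DecidablePred P] :
    ((arcsWithin 1 S).filter fun π => P (π 0)).card =
      (if P 0 then 1 else 0) + if P 1 ∧ S 0 then 1 else 0 := by
  rw [card_arcsWithin_succ_filter 0 S P]
  have : arcsWithin 0 (fun j => S (j + 1)) = {1} := by
    ext π
    simp [arcsWithin, isArc_fin_one, descentsIn_fin_one, Subsingleton.elim (α := Equiv.Perm (Fin 1)) π 1]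
  rw [this, Finset.sum_singleton, Finset.card_filter, Fin.sum_univ_two]
  simp [CyclicAdj]

open Classical in
theorem arcCount_one (S : ℕ → Prop) : arcCount 1 S = 1 + if S 0 then 1 else 0 := by
  have := card_arcsWithin_one_filter S (fun _ => True)
  simpa [arcCount] using this

theorem botCount_one (S : ℕ → Prop) : botCount 1 S = 1 := by
  have := card_arcsWithin_one_filter S (fun v => v = 0)
  simpa [botCount] using this

open Classical in
theorem topCount_one (S : ℕ → Prop) : topCount 1 S = if S 0 then 1 else 0 := by
  have := card_arcsWithin_one_filter S (fun v => v = Fin.last 1)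
  simpa [topCount] using this

/-! ### Monomial statistics and the closed formula -/

/-- The number of distinct variables in a monomial. -/
def numVars (m : ℕ →₀ ℕ) : ℕ := m.support.card

/-- The number of variables whose square divides a monomial. -/
def numSquares (m : ℕ →₀ ℕ) : ℕ := (m.support.filter fun i => 2 ≤ m i).card

/-- The monomial `x_{a 0} ⋯ x_{a (n - 1)}`. -/
noncomputable def content (n : ℕ) (a : ℕ → ℕ) : ℕ →₀ ℕ :=
  ∑ i ∈ Finset.range n, Finsupp.single (a i) 1

theorem content_succ (n : ℕ) (a : ℕ → ℕ) :
    content (n + 1) a = content n (fun i => a (i + 1)) + Finsupp.single (a 0) 1 := by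
  rw [content, Finset.sum_range_succ', content]

theorem content_apply_eq_zero {n : ℕ} {a : ℕ → ℕ} {x : ℕ} (h : ∀ i, x < a i) :
    content n a x = 0 := by
  rw [content, Finsupp.finsetSum_apply]
  exact Finset.sum_eq_zero fun i _ => Finsupp.single_eq_of_ne (h i).ne

theorem numVars_add_single (m : ℕ →₀ ℕ) (x : ℕ) :
    numVars (m + Finsupp.single x 1) = numVars m + if m x = 0 then 1 else 0 := by
  have : (m + Finsupp.single x 1).support = insert x m.support := by
    ext i
    by_cases h : i = x <;> simp [h, eq_comm]
  rw [numVars, numVars, this, Finset.card_insert_eq_ite]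
  simp only [Finsupp.mem_support_iff]
  split_ifs <;> simp_all

theorem numSquares_add_single (m : ℕ →₀ ℕ) (x : ℕ) :
    numSquares (m + Finsupp.single x 1) = numSquares m + if m x = 1 then 1 else 0 := by
  have : ∀ m : ℕ →₀ ℕ, numSquares m = ∑ i ∈ m.support ∪ {x}, if 2 ≤ m i then 1 else 0 := by
    intro m
    rw [numSquares, Finset.card_filter]
    refine Finset.sum_subset Finset.subset_union_left fun i _ hi => ?_
    rw [Finsupp.notMem_support_iff.1 hi]; rfl
  have hs : (m + Finsupp.single x 1).support ∪ {x} = m.support ∪ {x} := by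
    ext i
    by_cases h : i = x <;> simp [h, eq_comm]
  rw [this, this, hs, ← Finset.sum_erase_add _ _ (show x ∈ m.support ∪ {x} by simp),
    ← Finset.sum_erase_add (a := x) (f := fun i => if 2 ≤ m i then 1 else 0) _ (by simp), add_assoc]
  congr 1
  · refine Finset.sum_congr rfl fun i hi => ?_
    rw [Finsupp.add_apply, Finsupp.single_eq_of_ne (Finset.ne_of_mem_erase hi), add_zero]
  · simp only [Finsupp.add_apply, Finsupp.single_eq_same]
    split_ifs <;> omega

-- The three identities are closed under the recursion, read by prefixing a variable to a. Write T,
-- B, U for the total, bottom and top counts. A new smaller variable gives 2T + B + U in place of T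
-- and raises v by one. A repeated first variable gives T + U, where U vanishes unless that variable
-- had occurred only once, exactly the case in which s grows.
open Classical in
theorem arcCount_formula (n : ℕ) (hn : 1 ≤ n) (a : ℕ → ℕ) (ha : Monotone a) :
    4 * arcCount n (fun j => a j < a (j + 1)) =
      2 ^ numVars (content (n + 1) a) *
        (numVars (content (n + 1) a) + numSquares (content (n + 1) a)) ∧
    2 * (botCount n (fun j => a j < a (j + 1)) + topCount n (fun j => a j < a (j + 1))) =
      2 ^ numVars (content (n + 1) a) ∧
    4 * topCount n (fun j => a j < a (j + 1)) =
      if a 0 < a 1 then 2 ^ numVars (content (n + 1) a) else 0 := by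
  have hmono : ∀ i, a 0 ≤ a (i + 1) := fun i => ha (Nat.zero_le _)
  induction n, hn using Nat.le_induction generalizing a with
  | base =>
    rw [arcCount_one, botCount_one, topCount_one]
    simp only [content_succ, numVars_add_single, numSquares_add_single]
    have h0 := hmono 0
    by_cases h : a 0 < a 1
    · simp [content, numVars, numSquares, h, h.ne']
    · have h' : a 0 = a 1 := by simp at h0; omega
      simp [content, numVars, numSquares, h']
  | succ n hn ih =>
    obtain ⟨h1, h2, h3⟩ := ih (fun i => a (i + 1)) (fun i j hij => ha (by omega))
      (fun i => ha (by omega))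
    rw [arcCount_succ hn, botCount_succ hn, topCount_succ hn]
    rw [content_succ (n + 1) a, numVars_add_single, numSquares_add_single]
    simp only [zero_add] at *
    set T := arcCount n (fun j => a (j + 1) < a (j + 1 + 1))
    set B := botCount n (fun j => a (j + 1) < a (j + 1 + 1))
    set U := topCount n (fun j => a (j + 1) < a (j + 1 + 1))
    set m := content (n + 1) (fun i => a (i + 1)) with hm
    by_cases h : a 0 < a 1
    · have hz : m (a 0) = 0 := content_apply_eq_zero fun i => lt_of_lt_of_le h (ha (by omega))
      simp only [h, hz, if_true]
      simp only [zero_ne_one, if_false, add_zero]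
      rw [pow_succ]
      refine ⟨?_, by omega, by omega⟩
      nlinarith
    · have h' : a 0 = a 1 := by have := hmono 0; simp at this; omega
      simp only [h, if_false]
      have hsucc : m (a 0) = content n (fun i => a (i + 1 + 1)) (a 1) + 1 := by
        rw [hm, content_succ, h', Finsupp.add_apply, zero_add, Finsupp.single_eq_same]
      by_cases hh : a 1 < a (1 + 1)
      · have hz : content n (fun i => a (i + 1 + 1)) (a 1) = 0 :=
          content_apply_eq_zero fun i => lt_of_lt_of_le hh (ha (by omega))
        rw [hsucc, hz]
        rw [if_pos hh] at h3
        simp only [zero_add, if_true, one_ne_zero, if_false, add_zero]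
        refine ⟨?_, by omega, trivial⟩
        nlinarith
      · have hh' : a 1 = a (1 + 1) := le_antisymm (ha (by omega)) (by omega)
        rw [if_neg hh] at h3
        -- The first variable already had exponent at least 2, so repeating it changes neither
        -- statistic.
        have h2m : m (a 0) ≠ 1 := by
          obtain ⟨k, rfl⟩ : ∃ k, n = k + 1 := ⟨n - 1, by omega⟩
          rw [hsucc, content_succ, Finsupp.add_apply, hh']
          simp
        have h1m : m (a 0) ≠ 0 := by omega
        simp only [h1m, h2m, if_false, add_zero]
        have : U = 0 := by omega
        rw [this] at h2 ⊢
        exact ⟨by simpa using h1, by omega, trivial⟩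

/-! ### The multiset product `C_n L_n` -/

/-- A proper prefix omits the last letter. If that letter is extreme, no proper prefix can wrap
around; if it is not, the first n - 1 letters leave a gap. -/
theorem isLeftUnimodal_iff {n : ℕ} (hn : 2 ≤ n) (σ : Equiv.Perm (Fin n)) :
    IsLeftUnimodal σ ↔
      IsArc σ ∧ ((σ ⟨n - 1, by omega⟩ : ℕ) = 0 ∨ (σ ⟨n - 1, by omega⟩ : ℕ) = n - 1) := by
  constructor
  · intro h
    constructor
    · intro j hj1 hjn
      obtain ⟨a, b, hab⟩ := h j hj1 hjn
      refine ⟨a, b, ?_⟩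
      rw [← hab, Set.image_image]
      refine Set.image_congr fun i _ => ?_
      push_cast; rfl
    · by_contra hc
      push Not at hc
      obtain ⟨a, b, hab⟩ := h (n - 1) (by omega) (by omega)
      set v := σ ⟨n - 1, by omega⟩ with hv
      have hmem : ∀ y : Fin n, y ≠ v → ((y : ℤ) + 1) ∈ Set.Icc a b := by
        intro y hy
        rw [← hab]
        refine ⟨σ.symm y, ?_, by simp⟩
        have h1 : σ.symm y ≠ ⟨n - 1, by omega⟩ := by
          intro h; apply hy; rw [hv, ← h]; simp
        have := (σ.symm y).2
        simp only [ne_eq, Fin.ext_iff] at h1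
        simp only [Set.mem_ofPred_eq]
        omega
      have hv2 := v.2
      have h1 := hmem ⟨v - 1, by omega⟩ (by simp [Fin.ext_iff]; omega)
      have h2 := hmem ⟨v + 1, by omega⟩ (by simp [Fin.ext_iff])
      have h3 : ((v : ℤ) + 1) ∈ Set.Icc a b := by
        simp only [Set.mem_Icc] at *
        push_cast at *
        omega
      rw [← hab] at h3
      obtain ⟨i, hi, hi'⟩ := h3
      have : σ i = v := by ext; simp at hi'; exact_mod_cast hi'
      rw [hv] at this
      have := σ.injective this
      rw [this] at hi
      simp at hi
  · rintro ⟨h, hlast⟩ j hj1 hjn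
    rcases eq_or_lt_of_le hjn with rfl | hjn
    · refine ⟨1, j, ?_⟩
      ext z
      simp only [Set.mem_image, Set.mem_ofPred_eq, Set.mem_Icc]
      constructor
      · rintro ⟨i, _, rfl⟩
        have := (σ i).2
        omega
      · rintro ⟨h1, h2⟩
        exact ⟨σ.symm ⟨(z - 1).toNat, by omega⟩, Fin.isLt _, by simp; omega⟩
    · rw [isArc_iff] at h
      induction j, hj1 using Nat.le_induction with
      | base =>
        refine ⟨(σ ⟨0, by omega⟩ : ℤ) + 1, (σ ⟨0, by omega⟩ : ℤ) + 1, ?_⟩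
        have : {i : Fin n | (i : ℕ) < 1} = {⟨0, by omega⟩} := by
          ext i; simp [Fin.ext_iff]
        rw [this, Set.Icc_self, Set.image_singleton]
      | succ j hj1 ih =>
        obtain ⟨a, b, hab⟩ := ih (by omega) (by omega)
        obtain ⟨i, hij, hadj⟩ := h ⟨j, by omega⟩ (by simp; omega)
        have hset : {i : Fin n | (i : ℕ) < j + 1} =
            insert ⟨j, by omega⟩ {i : Fin n | (i : ℕ) < j} := by
          ext i; simp [Fin.ext_iff]; omega
        have hz : ((σ i : ℤ) + 1) ∈ Set.Icc a b := by
          rw [← hab]; exact ⟨i, hij, rfl⟩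
        rw [Fin.lt_def] at hij
        simp only at hij
        have hne1 : (σ i : ℕ) ≠ σ ⟨n - 1, by omega⟩ := by
          intro h; have := σ.injective (Fin.ext h); rw [Fin.ext_iff] at this; simp at this; omega
        have hne2 : (σ ⟨j, by omega⟩ : ℕ) ≠ σ ⟨n - 1, by omega⟩ := by
          intro h; have := σ.injective (Fin.ext h); rw [Fin.ext_iff] at this; simp at this; omega
        rw [hset, Set.image_insert_eq, hab]
        set y := σ ⟨j, by omega⟩
        unfold CyclicAdj at hadj
        simp only [Set.mem_Icc] at hz
        -- The only wrap-around adjacency is between 0 and n - 1, one of which is the last letter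
        -- and is therefore neither σ i nor y. So y is an integer neighbour of σ i.
        refine ⟨min a (y + 1), max b (y + 1), ?_⟩
        ext z
        simp only [Set.mem_insert_iff, Set.mem_Icc]
        omega

/-- With letters in `Fin (n + 1)` the group C consists of the translations by k. -/
theorem mem_cyclicPerms_iff {n : ℕ} (c : Equiv.Perm (Fin (n + 1))) :
    c ∈ cyclicPerms (n + 1) ↔ ∃ k, c = Equiv.addRight k := by
  have hrot : finRotate (n + 1) = Equiv.addRight 1 := by
    ext x; simp
  have hpow : ∀ k : ℕ, finRotate (n + 1) ^ k = Equiv.addRight (k • (1 : Fin (n + 1))) := by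
    intro k
    induction k with
    | zero => ext x; simp
    | succ k ih => rw [pow_succ, ih, hrot]; ext x; simp [succ_nsmul, add_assoc, add_comm]
  have hval : ∀ k : Fin (n + 1), (k : ℕ) • (1 : Fin (n + 1)) = k := by
    intro k
    induction k using Fin.induction with
    | zero => simp
    | succ k ih => rw [Fin.val_succ, succ_nsmul, ← Fin.val_castSucc, ih, Fin.coeSucc_eq_succ]
  simp only [cyclicPerms, Finset.mem_filter, Finset.mem_univ, true_and]
  constructor
  · intro h
    rw [← mem_powers_iff_mem_zpowers] at h
    obtain ⟨k, rfl⟩ := h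
    exact ⟨_, hpow k⟩
  · rintro ⟨k, rfl⟩
    refine ⟨(k : ℕ), ?_⟩
    simp only [zpow_natCast]
    rw [hpow, hval]

theorem cyclicAdj_fin_iff {n : ℕ} (x y : Fin (n + 1)) :
    CyclicAdj (n + 1) x y ↔ (y = x + 1 ∨ x = y + 1) := by
  have h : ∀ x y : Fin (n + 1), y = x + 1 ↔ ((x : ℕ) + 1 = y ∨ ((y : ℕ) = 0 ∧ (x : ℕ) + 1 = n + 1)) := by
    intro x y
    have := x.2
    have := y.2
    rw [Fin.ext_iff, Fin.val_add_one]
    split_ifs with h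
    · rw [Fin.ext_iff, Fin.val_last] at h; omega
    · rw [Fin.ext_iff, Fin.val_last] at h; omega
  rw [h, h]
  unfold CyclicAdj
  tauto

theorem isArc_addRight_mul {n : ℕ} (k : Fin (n + 1)) (π : Equiv.Perm (Fin (n + 1))) :
    IsArc (Equiv.addRight k * π) ↔ IsArc π := by
  simp only [isArc_iff, cyclicAdj_fin_iff, Equiv.Perm.coe_mul, Function.comp_apply,
    Equiv.coe_addRight, add_right_comm _ k 1, add_left_inj]

theorem multisetProduct_cyclic_leftUnimodal {n : ℕ} (hn : 1 ≤ n) :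
    multisetProduct (cyclicPerms (n + 1)) (leftUnimodalPerms (n + 1)) =
      2 • (arcPerms (n + 1)).val := by
  classical
  ext τ
  rw [Multiset.count_nsmul, multisetProduct, Multiset.count_map]
  have hcard : (((cyclicPerms (n + 1)) ×ˢ (leftUnimodalPerms (n + 1))).filter
      fun p => τ = p.1 * p.2).card = if IsArc τ then 2 else 0 := by
    -- In a factorization the rotation k determines the other factor. Its last letter is `τ
    -- (Fin.last n) - k`, which is extreme iff it equals 0 or -1.
    have hL : ∀ k : Fin (n + 1), (Equiv.addRight k)⁻¹ * τ ∈ leftUnimodalPerms (n + 1) ↔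
        IsArc τ ∧ (k = τ (Fin.last n) ∨ k = τ (Fin.last n) + 1) := by
      intro k
      have hinv : (Equiv.addRight k)⁻¹ = Equiv.addRight (-k) := by
        ext x; simp
      have hlast : (⟨n + 1 - 1, by omega⟩ : Fin (n + 1)) = Fin.last n := rfl
      rw [leftUnimodalPerms, Finset.mem_filter, isLeftUnimodal_iff (by omega), hinv,
        isArc_addRight_mul, hlast]
      simp only [Finset.mem_univ, true_and, Equiv.Perm.coe_mul, Function.comp_apply,
        Equiv.coe_addRight, Nat.add_sub_cancel]
      have h0 : ∀ x : Fin (n + 1), (x : ℕ) = 0 ↔ x = 0 := fun x => by rw [Fin.ext_iff]; rfl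
      have h1 : ∀ x : Fin (n + 1), (x : ℕ) = n ↔ x = -1 := fun x => by
        rw [eq_neg_iff_add_eq_zero.2 (Fin.last_add_one n) |>.symm, Fin.ext_iff, Fin.val_last]
      rw [h0, h1, ← sub_eq_add_neg, sub_eq_zero, sub_eq_iff_eq_add, eq_comm (a := τ (Fin.last n))]
      refine and_congr_right fun _ => or_congr_right ?_
      rw [neg_add_eq_sub, eq_sub_iff_add_eq, eq_comm]
    have himg : (((cyclicPerms (n + 1)) ×ˢ (leftUnimodalPerms (n + 1))).filter
        fun p => τ = p.1 * p.2) =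
        (if IsArc τ then {τ (Fin.last n), τ (Fin.last n) + 1} else ∅ : Finset (Fin (n + 1))).image
          fun k => (Equiv.addRight k, (Equiv.addRight k)⁻¹ * τ) := by
      ext ⟨c, σ⟩
      simp only [Finset.mem_filter, Finset.mem_product, Finset.mem_image, Prod.mk.injEq,
        mem_cyclicPerms_iff]
      constructor
      · rintro ⟨⟨⟨k, rfl⟩, hσ⟩, h⟩
        have hσ' : σ = (Equiv.addRight k)⁻¹ * τ := by rw [h]; group
        rw [hσ', hL] at hσ
        refine ⟨k, ?_, rfl, hσ'.symm⟩
        rw [if_pos hσ.1]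
        simpa using hσ.2
      · rintro ⟨k, hk, rfl, rfl⟩
        refine ⟨⟨⟨k, rfl⟩, (hL k).2 ?_⟩, by group⟩
        split_ifs at hk with h
        · exact ⟨h, by simpa using hk⟩
        · simp at hk
    rw [himg, Finset.card_image_of_injective]
    · split_ifs with h
      · rw [Finset.card_pair]
        intro h
        have h1 : (1 : Fin (n + 1)) = 0 := by simpa using h.symm
        rw [Fin.one_eq_zero_iff] at h1
        omega
      · rfl
    · intro k k' h
      have := congrArg (fun p => p.1 0) h
      simpa using this
  rw [← Finset.filter_val, ← Finset.card_def, hcard, Multiset.count_eq_of_nodup (Finset.nodup _)]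
  simp only [arcPerms, Finset.mem_val, Finset.mem_filter, Finset.mem_univ, true_and]
  split_ifs <;> rfl

/-! ### Coefficients of fundamental quasisymmetric functions -/

theorem degree_content (n : ℕ) (a : ℕ → ℕ) : (content n a).degree = n := by
  simp [content]

theorem content_succ_last (n : ℕ) (a : ℕ → ℕ) :
    content (n + 1) a = content n a + Finsupp.single (a n) 1 := by
  rw [content, Finset.sum_range_succ, content]

theorem content_congr {n : ℕ} {a b : ℕ → ℕ} (h : ∀ i < n, a i = b i) :
    content n a = content n b :=
  Finset.sum_congr rfl fun i hi => by rw [h i (Finset.mem_range.1 hi)]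

theorem mem_support_content {n : ℕ} {a : ℕ → ℕ} {x : ℕ} :
    x ∈ (content n a).support ↔ ∃ i < n, a i = x := by
  rw [Finsupp.mem_support_iff, content, Finsupp.finsetSum_apply, Ne, Finset.sum_eq_zero_iff]
  simp [Finsupp.single_apply]

theorem content_apply_pos {n : ℕ} {a : ℕ → ℕ} {x : ℕ} :
    0 < content n a x ↔ ∃ i < n, a i = x := by
  rw [← mem_support_content, Finsupp.mem_support_iff, Nat.pos_iff_ne_zero]

theorem toMultiset_content (n : ℕ) (a : ℕ → ℕ) :
    Finsupp.toMultiset (content n a) = ((List.range n).map a : List ℕ) := by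
  induction n with
  | zero => simp [content]
  | succ n ih =>
    rw [content_succ_last, map_add, ih, List.range_succ, List.map_append, ← Multiset.coe_add]
    simp

/-- Two sorted lists with the same multiset of entries agree. Monotonicity is required only below n
because the lemma is also applied to rows and columns of tableaux, whose entries drop to 0 outside
the shape. -/
theorem eq_of_content_eq {n : ℕ} {a b : ℕ → ℕ} (ha : ∀ i j, i < j → j < n → a i ≤ a j)
    (hb : ∀ i j, i < j → j < n → b i ≤ b j) (h : content n a = content n b) :
    ∀ i < n, a i = b i := by
  have hs : ∀ a : ℕ → ℕ, (∀ i j, i < j → j < n → a i ≤ a j) →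
      ((List.range n).map a).Pairwise (· ≤ ·) := by
    intro a ha
    rw [List.pairwise_map]
    exact List.Pairwise.imp_of_mem
      (fun _ hj hij => ha _ _ hij (List.mem_range.1 hj)) List.pairwise_lt_range
  have h' := congrArg Finsupp.toMultiset h
  rw [toMultiset_content, toMultiset_content, Multiset.coe_eq_coe] at h'
  have := h'.eq_of_pairwise' (hs a ha) (hs b hb)
  simpa using this

/-- Remove one copy of the largest variable, sort the rest, and put that copy at the end. The
sequence stays constant from there on, to be monotone on all of ℕ. -/
theorem exists_monotone_content (m : ℕ →₀ ℕ) :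
    ∃ a : ℕ → ℕ, Monotone a ∧ content m.degree a = m := by
  obtain ⟨n, hn⟩ : ∃ n, m.degree = n := ⟨_, rfl⟩
  rw [hn]
  induction n generalizing m with
  | zero =>
    exact ⟨fun _ => 0, monotone_const, by
      rw [(Finsupp.degree_eq_zero_iff m).1 hn]; simp [content]⟩
  | succ n ih =>
    have hne : m.support.Nonempty := by
      rw [Finsupp.support_nonempty_iff]
      rintro rfl
      simp at hn
    set x := m.support.max' hne with hx
    have hxm : Finsupp.single x 1 ≤ m := by
      rw [Finsupp.single_le_iff]
      exact Nat.one_le_iff_ne_zero.2 (Finsupp.mem_support_iff.1 (Finset.max'_mem _ hne))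
    have hsplit : m - Finsupp.single x 1 + Finsupp.single x 1 = m := tsub_add_cancel_of_le hxm
    obtain ⟨a, ha, hc⟩ := ih (m - Finsupp.single x 1) (by
      have := congrArg Finsupp.degree hsplit
      rw [map_add, Finsupp.degree_single, hn] at this
      omega)
    have hle : ∀ i < n, a i ≤ x := by
      intro i hi
      have : a i ∈ (m - Finsupp.single x 1).support := by
        rw [← hc]; exact mem_support_content.2 ⟨i, hi, rfl⟩
      exact Finset.le_max' _ _ (Finsupp.support_mono tsub_le_self this)
    refine ⟨fun i => if i < n then a i else x, ?_, ?_⟩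
    · intro i j hij
      simp only
      split_ifs with h1 h2 h2
      · exact ha hij
      · exact hle i h1
      · omega
      · exact le_rfl
    · rw [content_succ_last, if_neg (lt_irrefl n), ← hsplit, ← hc]
      congr 1
      exact content_congr fun i hi => if_pos hi

theorem sum_univ_single_eq_content {n : ℕ} (b : Fin n → ℕ) (a : ℕ → ℕ) (h : ∀ i, b i = a i) :
    ∑ i, Finsupp.single (b i) 1 = content n a := by
  rw [content, Finset.sum_range]
  exact Finset.sum_congr rfl fun i _ => by rw [h]

-- The only weakly increasing sequence with this content is a itself, so the coefficient just tests
-- whether a satisfies the strict inequalities of D.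
open Classical in
theorem fundamental_content (n : ℕ) (D : Finset (Fin (n - 1))) {a : ℕ → ℕ} (ha : Monotone a) :
    fundamental n D (content n a) = if ∀ j ∈ D, a j < a (j + 1) then 1 else 0 := by
  have huniq : ∀ b : Fin n → ℕ, Monotone b → ∑ i, Finsupp.single (b i) 1 = content n a →
      ∀ i, b i = a i := by
    intro b hb hc i
    set b' : ℕ → ℕ := fun i => if h : i < n then b ⟨i, h⟩ else 0
    have hb' : ∀ i : Fin n, b i = b' i := fun i => by simp [b']
    rw [sum_univ_single_eq_content b b' hb'] at hc
    rw [hb', eq_of_content_eq ?_ (fun i j hij _ => ha hij.le) hc i i.2]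
    intro i j hij hj
    simp only [b', hj, hij.trans hj, dif_pos]
    exact hb (by simp [Fin.le_def, hij.le])
  unfold fundamental
  split_ifs with h
  · rw [Nat.card_eq_one_iff_unique.2]
    · simp
    refine ⟨⟨fun b c => Subtype.ext (funext fun i => ?_)⟩,
      ⟨⟨fun i => a i, fun i j hij => ha hij, h, sum_univ_single_eq_content _ a fun _ => rfl⟩⟩⟩
    rw [huniq _ b.2.1 b.2.2.2, huniq _ c.2.1 c.2.2.2]
  · rw [Nat.card_eq_zero.2 (Or.inl ⟨fun b => h ?_⟩)]
    · simp
    intro j hj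
    have := b.2.2.1 j hj
    rwa [huniq _ b.2.1 b.2.2.2, huniq _ b.2.1 b.2.2.2] at this

theorem fundamental_eq_zero {n : ℕ} (D : Finset (Fin (n - 1))) {m : ℕ →₀ ℕ} (hm : m.degree ≠ n) :
    fundamental n D m = 0 := by
  unfold fundamental
  rw [Nat.card_eq_zero.2 (Or.inl ⟨fun b => hm ?_⟩)]
  · simp
  · rw [← b.2.2.2]; simp

theorem quasisymmetricFunction_apply {n : ℕ} (A : Finset (Equiv.Perm (Fin n))) (m : ℕ →₀ ℕ) :
    quasisymmetricFunction A m = ∑ π ∈ A, fundamental n (descentSet π) m := by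
  rw [quasisymmetricFunction]
  exact map_sum (MvPowerSeries.coeff m) _ _

theorem quasisymmetricFunction_arcPerms_content (n : ℕ) {a : ℕ → ℕ} (ha : Monotone a) :
    quasisymmetricFunction (arcPerms (n + 1)) (content (n + 1) a) =
      arcCount n (fun j => a j < a (j + 1)) := by
  classical
  rw [quasisymmetricFunction_apply, arcCount, arcsWithin, ← Finset.filter_filter,
    Finset.card_filter, arcPerms]
  push_cast
  refine Finset.sum_congr rfl fun π _ => ?_
  rw [fundamental_content _ _ ha]
  refine if_congr ?_ rfl rfl
  exact ⟨fun h j hj hd => h ⟨j, by omega⟩ (Finset.mem_filter.2 ⟨Finset.mem_univ _, hd⟩),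
    fun h j hj => h j (by have := j.2; omega) (Finset.mem_filter.1 hj).2⟩

theorem coeff_quasisymmetricFunction_arcPerms {n : ℕ} (hn : 1 ≤ n) {m : ℕ →₀ ℕ}
    (hm : m.degree = n + 1) :
    4 * quasisymmetricFunction (arcPerms (n + 1)) m =
      2 ^ numVars m * (numVars m + numSquares m) := by
  obtain ⟨a, ha, hc⟩ := exists_monotone_content m
  rw [hm] at hc
  rw [← hc, quasisymmetricFunction_arcPerms_content n ha]
  exact_mod_cast (arcCount_formula n hn a ha).1

theorem quasisymmetricFunction_eq_zero {n : ℕ} (A : Finset (Equiv.Perm (Fin n))) {m : ℕ →₀ ℕ}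
    (hm : m.degree ≠ n) : quasisymmetricFunction A m = 0 := by
  rw [quasisymmetricFunction_apply]
  exact Finset.sum_eq_zero fun π _ => fundamental_eq_zero _ hm

theorem numVars_mapDomain (e : Equiv.Perm ℕ) (m : ℕ →₀ ℕ) :
    numVars (m.mapDomain e) = numVars m := by
  rw [numVars, Finsupp.mapDomain_support_of_injective e.injective,
    Finset.card_image_of_injective _ e.injective, numVars]

theorem numSquares_mapDomain (e : Equiv.Perm ℕ) (m : ℕ →₀ ℕ) :
    numSquares (m.mapDomain e) = numSquares m := by
  rw [numSquares, Finsupp.mapDomain_support_of_injective e.injective, Finset.filter_image,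
    Finset.card_image_of_injective _ e.injective, numSquares]
  simp only [Finsupp.mapDomain_apply e.injective]

theorem isSymmetricFunction_arcPerms {n : ℕ} (hn : 1 ≤ n) :
    IsSymmetricFunction (n + 1) (quasisymmetricFunction (arcPerms (n + 1))) := by
  refine ⟨fun m hm => by_contra fun h => hm (quasisymmetricFunction_eq_zero _ h), fun e m => ?_⟩
  change quasisymmetricFunction (arcPerms (n + 1)) (m.mapDomain e) =
    quasisymmetricFunction (arcPerms (n + 1)) m
  have hdeg : (m.mapDomain e).degree = m.degree := by simp
  by_cases h : m.degree = n + 1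
  · have h1 := coeff_quasisymmetricFunction_arcPerms hn h
    have h2 := coeff_quasisymmetricFunction_arcPerms hn (hdeg.trans h)
    rw [numVars_mapDomain, numSquares_mapDomain, ← h1] at h2
    linarith
  · rw [quasisymmetricFunction_eq_zero _ h, quasisymmetricFunction_eq_zero _ (by rwa [hdeg])]

/-! ### Tableaux of hook and near-hook shape -/

theorem mem_diagram {l : Multiset ℕ} {w : List ℕ} (hw : w.Pairwise (· ≥ ·)) (hl : (w : Multiset ℕ) = l)
    (c : ℕ × ℕ) : c ∈ diagram l ↔ ∃ h : c.1 < w.length, c.2 < w[c.1] := by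
  have : l.sort (· ≥ ·) = w := by
    refine List.Perm.eq_of_pairwise' (l.pairwise_sort _) hw ?_
    rw [← Multiset.coe_eq_coe, Multiset.sort_eq, hl]
  subst this
  rw [diagram, YoungDiagram.mem_ofRowLens]

theorem mem_diagram_hook {p q : ℕ} (hp : 1 ≤ p) (i j : ℕ) :
    (i, j) ∈ diagram (p ::ₘ Multiset.replicate q 1) ↔
      (i = 0 ∧ j < p) ∨ (1 ≤ i ∧ i ≤ q ∧ j = 0) := by
  rw [mem_diagram (w := p :: List.replicate q 1)]
  · cases i with
    | zero => simp
    | succ i => simp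
  · simp [List.pairwise_replicate]; omega
  · rfl

theorem mem_diagram_nearHook {p q : ℕ} (hp : 2 ≤ p) (hq : 1 ≤ q) (i j : ℕ) :
    (i, j) ∈ diagram (p ::ₘ 2 ::ₘ Multiset.replicate (q - 1) 1) ↔
      (i = 0 ∧ j < p) ∨ (1 ≤ i ∧ i ≤ q ∧ j = 0) ∨ (i = 1 ∧ j = 1) := by
  rw [mem_diagram (w := p :: 2 :: List.replicate (q - 1) 1)]
  · rcases i with _ | _ | i
    · simp
    · simp; omega
    · simp; omega
  · simp [List.pairwise_replicate]; omega
  · rfl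

/-- The squarefree monomial `∏_{c ∈ C} x_c`. -/
noncomputable def indicator (C : Finset ℕ) : ℕ →₀ ℕ := ∑ c ∈ C, Finsupp.single c 1

theorem indicator_apply (C : Finset ℕ) (x : ℕ) : indicator C x = if x ∈ C then 1 else 0 := by
  rw [indicator, Finsupp.finsetSum_apply]
  simp [Finsupp.single_apply]

theorem degree_indicator (C : Finset ℕ) : (indicator C).degree = C.card := by
  simp [indicator]

theorem content_eq_indicator {n : ℕ} {a : ℕ → ℕ} (ha : ∀ i j, i < j → j < n → a i < a j) :
    content n a = indicator ((Finset.range n).image a) := by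
  rw [content, indicator, Finset.sum_image]
  intro i hi j hj hij
  simp only [Finset.coe_range, Set.mem_Iio] at hi hj
  by_contra hne
  rcases Nat.lt_or_gt_of_ne hne with h | h
  · exact absurd hij (ha i j h hj).ne
  · exact absurd hij (ha j i h hi).ne'

theorem two_le_content {n : ℕ} {a : ℕ → ℕ} {i j : ℕ} (hij : i < j) (hj : j < n) (h : a i = a j) :
    2 ≤ content n a (a j) := by
  have hsub : ({i, j} : Finset ℕ) ⊆ Finset.range n := by
    intro x; simp; omega
  rw [content, Finsupp.finsetSum_apply]
  refine le_trans ?_ (Finset.sum_le_sum_of_subset hsub)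
  rw [Finset.sum_pair hij.ne, h]
  simp

theorem exists_eq_of_two_le_content {n : ℕ} {a : ℕ → ℕ} {x : ℕ} (h : 2 ≤ content n a x) :
    ∃ i j, i < j ∧ j < n ∧ a i = x ∧ a j = x := by
  rw [content, Finsupp.finsetSum_apply] at h
  simp only [Finsupp.single_apply] at h
  rw [← Finset.card_filter] at h
  obtain ⟨i, hi, j, hj, hij⟩ := Finset.one_lt_card.1 h
  simp only [Finset.mem_filter, Finset.mem_range] at hi hj
  rcases Nat.lt_or_gt_of_ne hij with h | h
  · exact ⟨i, j, h, hj.1, hi.2, hj.2⟩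
  · exact ⟨j, i, h, hi.1, hj.2, hi.2⟩

theorem exists_strictMono_content (C : Finset ℕ) :
    ∃ b : ℕ → ℕ, (∀ i j, i < j → j < C.card → b i < b j) ∧ content C.card b = indicator C := by
  obtain ⟨b, hb, hc⟩ := exists_monotone_content (indicator C)
  rw [degree_indicator] at hc
  refine ⟨b, fun i j hij hj => lt_of_le_of_ne (hb hij.le) fun h => ?_, hc⟩
  have := two_le_content hij hj h
  rw [hc, indicator_apply] at this
  split_ifs at this <;> omega

/-! ### Tableaux determined by leg and inner entry -/

variable {μ : YoungDiagram} {p q : ℕ}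

/-- The cells of the hook with arm `p - 1` and leg `q`. -/
def IsHook (μ : YoungDiagram) (p q : ℕ) : Prop :=
  ∀ i j, (i, j) ∈ μ ↔ (i = 0 ∧ j < p) ∨ (1 ≤ i ∧ i ≤ q ∧ j = 0)

/-- The cells of the hook with arm `p - 1` and leg `q`, together with the cell `(1, 1)`. -/
def IsNearHook (μ : YoungDiagram) (p q : ℕ) : Prop :=
  ∀ i j, (i, j) ∈ μ ↔ (i = 0 ∧ j < p) ∨ (1 ≤ i ∧ i ≤ q ∧ j = 0) ∨ (i = 1 ∧ j = 1)

/-- The entries below the corner in the first column. -/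
def legSet (q : ℕ) (T : SemistandardYoungTableau μ) : Finset ℕ :=
  (Finset.range q).image fun i => T (i + 1) 0

theorem sum_hook_cells (M : ℕ × ℕ → ℕ →₀ ℕ) (p q : ℕ) :
    ∑ c ∈ (Finset.range p).image (fun j => (0, j)) ∪ (Finset.range q).image (fun i => (i + 1, 0)),
      M c = ∑ j ∈ Finset.range p, M (0, j) + ∑ i ∈ Finset.range q, M (i + 1, 0) := by
  rw [Finset.sum_union, Finset.sum_image, Finset.sum_image]
  · intro i _ j _ h; simpa using h
  · intro i _ j _ h; simpa using h
  · rw [Finset.disjoint_left]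
    rintro ⟨x, y⟩ h1 h2
    simp only [Finset.mem_image, Prod.mk.injEq] at h1 h2
    obtain ⟨_, _, h1, _⟩ := h1
    obtain ⟨_, _, h2, _⟩ := h2
    omega

theorem weight_hook (hμ : IsHook μ p q) (T : SemistandardYoungTableau μ) :
    weight T = content p (fun j => T 0 j) + content q (fun i => T (i + 1) 0) := by
  have hcells : μ.cells = (Finset.range p).image (fun j => (0, j)) ∪
      (Finset.range q).image (fun i => (i + 1, 0)) := by
    ext ⟨i, j⟩
    rw [YoungDiagram.mem_cells, hμ]
    simp only [Finset.mem_union, Finset.mem_image, Finset.mem_range, Prod.mk.injEq]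
    constructor
    · rintro (⟨rfl, h⟩ | ⟨h1, h2, rfl⟩)
      · exact Or.inl ⟨j, h, rfl, rfl⟩
      · exact Or.inr ⟨i - 1, by omega, by omega, rfl⟩
    · rintro (⟨j, h, rfl, rfl⟩ | ⟨i, h, rfl, rfl⟩)
      · exact Or.inl ⟨rfl, h⟩
      · exact Or.inr ⟨by omega, by omega, rfl⟩
  rw [weight, hcells, sum_hook_cells]
  rfl

theorem weight_nearHook (hμ : IsNearHook μ p q) (T : SemistandardYoungTableau μ) :
    weight T = content p (fun j => T 0 j) + content q (fun i => T (i + 1) 0) +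
      Finsupp.single (T 1 1) 1 := by
  have hcells : μ.cells = insert (1, 1) ((Finset.range p).image (fun j => (0, j)) ∪
      (Finset.range q).image (fun i => (i + 1, 0))) := by
    ext ⟨i, j⟩
    rw [YoungDiagram.mem_cells, hμ]
    simp only [Finset.mem_insert, Finset.mem_union, Finset.mem_image, Finset.mem_range,
      Prod.mk.injEq]
    constructor
    · rintro (⟨rfl, h⟩ | ⟨h1, h2, rfl⟩ | h)
      · exact Or.inr (Or.inl ⟨j, h, rfl, rfl⟩)
      · exact Or.inr (Or.inr ⟨i - 1, by omega, by omega, rfl⟩)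
      · exact Or.inl h
    · rintro (h | ⟨j, h, rfl, rfl⟩ | ⟨i, h, rfl, rfl⟩)
      · exact Or.inr (Or.inr h)
      · exact Or.inl ⟨rfl, h⟩
      · exact Or.inr (Or.inl ⟨by omega, by omega, rfl⟩)
  rw [weight, hcells, Finset.sum_insert, sum_hook_cells, add_comm]
  · rfl
  · simp

theorem content_leg (hμ : ∀ i, 1 ≤ i → i ≤ q → (i, 0) ∈ μ) (T : SemistandardYoungTableau μ) :
    content q (fun i => T (i + 1) 0) = indicator (legSet q T) :=
  content_eq_indicator fun _ _ hij hj => T.col_strict (by omega) (hμ _ (by omega) (by omega))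

theorem card_legSet (hμ : ∀ i, 1 ≤ i → i ≤ q → (i, 0) ∈ μ) (T : SemistandardYoungTableau μ) :
    (legSet q T).card = q := by
  rw [← degree_indicator, ← content_leg hμ, degree_content]

theorem leg_eq (hμ : ∀ i, 1 ≤ i → i ≤ q → (i, 0) ∈ μ) {T T' : SemistandardYoungTableau μ}
    (h : legSet q T = legSet q T') : ∀ i < q, T (i + 1) 0 = T' (i + 1) 0 := by
  have hc : content q (fun i => T (i + 1) 0) = content q (fun i => T' (i + 1) 0) := by
    rw [content_leg hμ, content_leg hμ, h]
  exact eq_of_content_eq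
    (fun i j hij hj => T.col_weak (by omega) (hμ _ (by omega) (by omega)))
    (fun i j hij hj => T'.col_weak (by omega) (hμ _ (by omega) (by omega))) hc

theorem arm_eq (hμ : ∀ j < p, (0, j) ∈ μ) {T T' : SemistandardYoungTableau μ}
    (h : content p (fun j => T 0 j) = content p (fun j => T' 0 j)) :
    ∀ j < p, T 0 j = T' 0 j :=
  eq_of_content_eq (fun _ _ hij hj => T.row_weak hij (hμ _ hj))
    (fun _ _ hij hj => T'.row_weak hij (hμ _ hj)) h

theorem tableau_ext {T T' : SemistandardYoungTableau μ} (h : ∀ i j, (i, j) ∈ μ → T i j = T' i j) :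
    T = T' := by
  ext i j
  by_cases hc : (i, j) ∈ μ
  · exact h i j hc
  · rw [T.zeros hc, T'.zeros hc]

/-- The corner holds the smallest variable v. The leg may be any q-subset of the other variables,
and the remaining letters, sorted, form the arm. -/
theorem card_tableaux_hook (hp : 1 ≤ p) (hμ : IsHook μ p q) {m : ℕ →₀ ℕ} (hm : m.degree = p + q)
    {v : ℕ} (hv : v ∈ m.support) (hmin : ∀ x ∈ m.support, v ≤ x) :
    Nat.card {T : SemistandardYoungTableau μ // weight T = m} =
      ((m.support.erase v).powersetCard q).card := by
  have hleg : ∀ i, 1 ≤ i → i ≤ q → (i, 0) ∈ μ := fun i h1 h2 => (hμ _ _).2 (Or.inr ⟨h1, h2, rfl⟩)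
  have harm : ∀ j < p, (0, j) ∈ μ := fun j h => (hμ _ _).2 (Or.inl ⟨rfl, h⟩)
  have hw : ∀ T : SemistandardYoungTableau μ, weight T =
      content p (fun j => T 0 j) + indicator (legSet q T) := fun T => by
    rw [weight_hook hμ, content_leg hleg]
  have hmem : ∀ T : {T : SemistandardYoungTableau μ // weight T = m},
      legSet q T.1 ∈ (m.support.erase v).powersetCard q := by
    rintro ⟨T, hT⟩
    rw [Finset.mem_powersetCard]
    refine ⟨fun x hx => ?_, card_legSet hleg T⟩
    have hxm : x ∈ m.support := by
      rw [Finsupp.mem_support_iff, ← hT, hw, Finsupp.add_apply, indicator_apply, if_pos hx]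
      omega
    have h0 : T 0 0 ∈ m.support := by
      have : 0 < content p (fun j => T 0 j) (T 0 0) := content_apply_pos.2 ⟨0, by omega, rfl⟩
      rw [Finsupp.mem_support_iff, ← hT, hw, Finsupp.add_apply]
      omega
    simp only [legSet, Finset.mem_image, Finset.mem_range] at hx
    obtain ⟨i, hi, rfl⟩ := hx
    have : T 0 0 < T (i + 1) 0 := T.col_strict (Nat.succ_pos i) (hleg (i + 1) (by omega) (by omega))
    have := hmin _ h0
    exact Finset.mem_erase.2 ⟨by omega, hxm⟩
  rw [← Fintype.card_coe, ← Nat.card_eq_fintype_card]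
  refine Nat.card_eq_of_bijective (fun T => ⟨legSet q T.1, hmem T⟩) ⟨?_, ?_⟩
  · rintro ⟨T, hT⟩ ⟨T', hT'⟩ h
    simp only [Subtype.mk.injEq] at h ⊢
    have hl := leg_eq hleg h
    have ha : content p (fun j => T 0 j) = content p (fun j => T' 0 j) := by
      have := hT.trans hT'.symm
      rw [hw, hw, h] at this
      exact add_right_cancel this
    have ha := arm_eq harm ha
    refine tableau_ext fun i j hc => ?_
    rcases (hμ i j).1 hc with ⟨rfl, h⟩ | ⟨h1, h2, rfl⟩
    · exact ha j h
    · obtain ⟨i, rfl⟩ : ∃ k, i = k + 1 := ⟨i - 1, by omega⟩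
      exact hl i (by omega)
  · rintro ⟨C, hC⟩
    rw [Finset.mem_powersetCard] at hC
    obtain ⟨hCs, rfl⟩ := hC
    have hvC : v ∉ C := fun h => by simpa using hCs h
    obtain ⟨b, hb, hbc⟩ := exists_strictMono_content C
    have hle : indicator C ≤ m := by
      intro x
      rw [indicator_apply]
      split_ifs with hx
      · exact Nat.one_le_iff_ne_zero.2 (Finsupp.mem_support_iff.1 (Finset.mem_of_mem_erase (hCs hx)))
      · exact Nat.zero_le _
    have hsplit : m - indicator C + indicator C = m := tsub_add_cancel_of_le hle
    obtain ⟨a, ha, hac⟩ := exists_monotone_content (m - indicator C)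
    have hdeg : (m - indicator C).degree = p := by
      have := congrArg Finsupp.degree hsplit
      rw [map_add, degree_indicator, hm] at this
      omega
    rw [hdeg] at hac
    have ha0 : a 0 ≤ v := by
      have : 0 < content p a v := by
        rw [hac, Finsupp.tsub_apply, indicator_apply, if_neg hvC]
        exact Nat.pos_of_ne_zero (Finsupp.mem_support_iff.1 hv)
      obtain ⟨i, _, hi⟩ := content_apply_pos.1 this
      rw [← hi]
      exact ha (Nat.zero_le i)
    have hbmem : ∀ i < C.card, b i ∈ C := by
      intro i hi
      have : 0 < content C.card b (b i) := content_apply_pos.2 ⟨i, hi, rfl⟩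
      rw [hbc, indicator_apply] at this
      by_contra h
      simp [h] at this
    have hab : ∀ i < C.card, a 0 < b i := by
      intro i hi
      have h1 := Finset.mem_erase.1 (hCs (hbmem i hi))
      have := hmin _ h1.2
      have := h1.1
      omega
    let T : SemistandardYoungTableau μ :=
      -- The sequence b starts at index 0 while the leg starts in row 1, hence `b (i - 1)`.
      { entry := fun i j => if (i, j) ∈ μ then (if i = 0 then a j else b (i - 1)) else 0
        row_weak' := by
          intro i j1 j2 hj hc
          have hc' : (i, j1) ∈ μ := μ.up_left_mem le_rfl hj.le hc
          rw [if_pos hc, if_pos hc']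
          rcases (hμ _ _).1 hc with ⟨rfl, h⟩ | ⟨h1, h2, rfl⟩
          · simpa using ha hj.le
          · omega
        col_strict' := by
          intro i1 i2 j hi hc
          have hc' : (i1, j) ∈ μ := μ.up_left_mem hi.le le_rfl hc
          rw [if_pos hc, if_pos hc']
          rcases (hμ _ _).1 hc with ⟨rfl, h⟩ | ⟨h1, h2, rfl⟩
          · omega
          · rw [if_neg (show i2 ≠ 0 by omega)]
            split_ifs with h
            · exact hab _ (by omega)
            · exact hb _ _ (by omega) (by omega)
        zeros' := fun hc => if_neg hc }
    have hT0 : ∀ j < p, T 0 j = a j := fun j hj => by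
      change (if (0, j) ∈ μ then (if 0 = 0 then a j else b (0 - 1)) else 0) = a j
      rw [if_pos (harm j hj), if_pos rfl]
    have hT1 : ∀ i < C.card, T (i + 1) 0 = b i := fun i hi => by
      change (if (i + 1, 0) ∈ μ then (if i + 1 = 0 then a 0 else b (i + 1 - 1)) else 0) = b i
      rw [if_pos (hleg _ (by omega) (by omega)), if_neg (by omega), Nat.add_sub_cancel]
    refine ⟨⟨T, ?_⟩, ?_⟩
    · rw [weight_hook hμ, content_congr hT0, content_congr hT1, hac, hbc, hsplit]
    · refine Subtype.ext ?_
      ext x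
      simp only [legSet, Finset.mem_image, Finset.mem_range]
      have : x ∈ C ↔ 0 < content C.card b x := by
        rw [hbc, indicator_apply]; split_ifs <;> simp_all
      rw [this, content_apply_pos]
      exact exists_congr fun i => and_congr_right fun hi => by rw [hT1 i hi]

/-- The pairs `(C, b)` such that the tableaux of near-hook shape with corner entry `v`, where
`s` are the values above `v`, are those with first column `v, C` and entry `b` in cell `(1, 1)`. -/
def legPairs (m : ℕ → ℕ) (e : Prop) [Decidable e] (s : Finset ℕ) : Finset (Finset ℕ × ℕ) :=
  (s.powerset ×ˢ s).filter fun p => (p.2 ∉ p.1 ∨ 2 ≤ m p.2) ∧ (∃ c ∈ p.1, c ≤ p.2) ∧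
    (e ∨ ∃ u ∈ s, u < p.2 ∧ (u ∉ p.1 ∨ 2 ≤ m u))

theorem mem_legPairs {m : ℕ → ℕ} {e : Prop} [Decidable e] {s C : Finset ℕ} {b : ℕ} :
    (C, b) ∈ legPairs m e s ↔ (C ⊆ s ∧ b ∈ s) ∧ (b ∉ C ∨ 2 ≤ m b) ∧ (∃ c ∈ C, c ≤ b) ∧
      (e ∨ ∃ u ∈ s, u < b ∧ (u ∉ C ∨ 2 ≤ m u)) := by
  simp only [legPairs, Finset.mem_filter, Finset.mem_product, Finset.mem_powerset]

/-- The conditions in `legPairs` say in turn: the monomial has enough copies of b for both the leg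
and cell (1, 1); the entry left of that cell, the least of the leg, is at most b; and the entry
above it is less than b. The last holds iff a second arm letter below b is available, either another
copy of v or some u left over from the leg. -/
theorem card_tableaux_nearHook (hp : 2 ≤ p) (hq : 1 ≤ q) (hμ : IsNearHook μ p q) {m : ℕ →₀ ℕ}
    (hm : m.degree = p + q + 1) {v : ℕ} (hv : v ∈ m.support) (hmin : ∀ x ∈ m.support, v ≤ x) :
    Nat.card {T : SemistandardYoungTableau μ // weight T = m} =
      ((legPairs m (2 ≤ m v) (m.support.erase v)).filter fun p => p.1.card = q).card := by
  have hleg : ∀ i, 1 ≤ i → i ≤ q → (i, 0) ∈ μ :=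
    fun i h1 h2 => (hμ _ _).2 (Or.inr (Or.inl ⟨h1, h2, rfl⟩))
  have harm : ∀ j < p, (0, j) ∈ μ := fun j h => (hμ _ _).2 (Or.inl ⟨rfl, h⟩)
  have h11 : (1, 1) ∈ μ := (hμ _ _).2 (Or.inr (Or.inr ⟨rfl, rfl⟩))
  have hw : ∀ T : SemistandardYoungTableau μ, weight T =
      content p (fun j => T 0 j) + indicator (legSet q T) + Finsupp.single (T 1 1) 1 := fun T => by
    rw [weight_nearHook hμ, content_leg hleg]
  have hmem : ∀ T : {T : SemistandardYoungTableau μ // weight T = m},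
      (legSet q T.1, T.1 1 1) ∈
        (legPairs m (2 ≤ m v) (m.support.erase v)).filter fun p => p.1.card = q := by
    rintro ⟨T, hT⟩
    have hmx : ∀ x, m x = content p (fun j => T 0 j) x + (if x ∈ legSet q T then 1 else 0) +
        Finsupp.single (T 1 1) 1 x := fun x => by
      rw [← hT, hw, Finsupp.add_apply, Finsupp.add_apply, indicator_apply]
    have hT0 : ∀ j < p, 0 < content p (fun j => T 0 j) (T 0 j) := fun j hj =>
      content_apply_pos.2 ⟨j, hj, rfl⟩
    have harm_mem : ∀ j < p, T 0 j ∈ m.support := by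
      intro j hj
      have := hT0 j hj
      rw [Finsupp.mem_support_iff, hmx]
      omega
    have h0 := hmin _ (harm_mem 0 (by omega))
    have h1 := hmin _ (harm_mem 1 (by omega))
    have h01 : T 0 0 ≤ T 0 1 := T.row_weak (by omega) (harm 1 (by omega))
    have h1b : T 0 1 < T 1 1 := T.col_strict (by omega) h11
    have hcb : T 1 0 ≤ T 1 1 := T.row_weak (by omega) h11
    refine Finset.mem_filter.2 ⟨mem_legPairs.2 ⟨⟨fun x hx => ?_, ?_⟩, ?_, ?_, ?_⟩, card_legSet hleg T⟩
    · have hxm : x ∈ m.support := by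
        rw [Finsupp.mem_support_iff, hmx, if_pos hx]
        omega
      simp only [legSet, Finset.mem_image, Finset.mem_range] at hx
      obtain ⟨i, hi, rfl⟩ := hx
      have : T 0 0 < T (i + 1) 0 := T.col_strict (Nat.succ_pos i) (hleg (i + 1) (by omega) (by omega))
      exact Finset.mem_erase.2 ⟨by omega, hxm⟩
    · refine Finset.mem_erase.2 ⟨by simp only; omega, ?_⟩
      rw [Finsupp.mem_support_iff, hmx, Finsupp.single_eq_same]
      omega
    · by_cases h : T 1 1 ∈ legSet q T
      · right
        rw [hmx, if_pos h, Finsupp.single_eq_same]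
        omega
      · exact Or.inl h
    · refine ⟨T 1 0, ?_, hcb⟩
      exact Finset.mem_image.2 ⟨0, Finset.mem_range.2 (by omega), rfl⟩
    -- If the entry above cell (1, 1) is v, so is the corner, and v occurs twice; otherwise that
    -- entry serves as u.
    · by_cases h : T 0 1 = v
      · left
        have := two_le_content (n := p) (a := fun j => T 0 j) (i := 0) (j := 1) (by omega) (by omega)
          (by omega)
        simp only [h] at this
        rw [hmx]
        omega
      · right
        refine ⟨T 0 1, Finset.mem_erase.2 ⟨h, harm_mem 1 (by omega)⟩, h1b, ?_⟩
        by_cases h' : T 0 1 ∈ legSet q T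
        · right
          have := hT0 1 (by omega)
          rw [hmx, if_pos h']
          omega
        · exact Or.inl h'
  rw [← Fintype.card_coe, ← Nat.card_eq_fintype_card]
  refine Nat.card_eq_of_bijective (fun T => ⟨(legSet q T.1, T.1 1 1), hmem T⟩) ⟨?_, ?_⟩
  · rintro ⟨T, hT⟩ ⟨T', hT'⟩ h
    simp only [Subtype.mk.injEq, Prod.mk.injEq] at h ⊢
    obtain ⟨h, hb⟩ := h
    have hl := leg_eq hleg h
    have ha : content p (fun j => T 0 j) = content p (fun j => T' 0 j) := by
      have := hT.trans hT'.symm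
      rw [hw, hw, h, hb] at this
      exact add_right_cancel (add_right_cancel this)
    have ha := arm_eq harm ha
    refine tableau_ext fun i j hc => ?_
    rcases (hμ i j).1 hc with ⟨rfl, h⟩ | ⟨h1, h2, rfl⟩ | ⟨rfl, rfl⟩
    · exact ha j h
    · obtain ⟨i, rfl⟩ : ∃ k, i = k + 1 := ⟨i - 1, by omega⟩
      exact hl i (by omega)
    · exact hb
  · rintro ⟨⟨C, β⟩, hC⟩
    rw [Finset.mem_filter, mem_legPairs] at hC
    obtain ⟨⟨⟨hCs, hβ⟩, hβC, ⟨c, hcC, hcβ⟩, hu⟩, hcard⟩ := hC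
    simp only at hcard
    subst hcard
    have hvC : v ∉ C := fun h => by simpa using hCs h
    have hβv := (Finset.mem_erase.1 hβ).1
    have hβm := (Finset.mem_erase.1 hβ).2
    have hvβ : v < β := lt_of_le_of_ne (hmin _ hβm) hβv.symm
    obtain ⟨b, hb, hbc⟩ := exists_strictMono_content C
    have hle : indicator C + Finsupp.single β 1 ≤ m := by
      intro x
      rw [Finsupp.add_apply, indicator_apply]
      have h1 : x ∈ C → 1 ≤ m x := fun hx =>
        Nat.one_le_iff_ne_zero.2 (Finsupp.mem_support_iff.1 (Finset.mem_of_mem_erase (hCs hx)))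
      by_cases hxβ : x = β
      · subst hxβ
        rw [Finsupp.single_eq_same]
        have := Nat.one_le_iff_ne_zero.2 (Finsupp.mem_support_iff.1 hβm)
        split_ifs with hx
        · rcases hβC with h | h
          · exact absurd hx h
          · omega
        · omega
      · rw [Finsupp.single_eq_of_ne hxβ]
        split_ifs with hx
        · exact h1 hx
        · omega
    have hsplit : m - (indicator C + Finsupp.single β 1) + (indicator C + Finsupp.single β 1) = m :=
      tsub_add_cancel_of_le hle
    set m1 := m - (indicator C + Finsupp.single β 1) with hm1
    have hm1x : ∀ x, x ≠ β → m1 x = m x - if x ∈ C then 1 else 0 := by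
      intro x hx
      rw [hm1, Finsupp.tsub_apply, Finsupp.add_apply, indicator_apply, Finsupp.single_eq_of_ne hx,
        add_zero]
    obtain ⟨a, ha, hac⟩ := exists_monotone_content m1
    have hdeg : m1.degree = p := by
      have := congrArg Finsupp.degree hsplit
      rw [map_add, map_add, degree_indicator, Finsupp.degree_single, hm] at this
      omega
    rw [hdeg] at hac
    have hm1v : m1 v = m v := by rw [hm1x v hβv.symm, if_neg hvC, Nat.sub_zero]
    have ha0 : a 0 ≤ v := by
      have : 0 < content p a v := by
        rw [hac, hm1v]
        exact Nat.pos_of_ne_zero (Finsupp.mem_support_iff.1 hv)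
      obtain ⟨i, _, hi⟩ := content_apply_pos.1 this
      rw [← hi]
      exact ha (Nat.zero_le i)
    -- The arm contains either two copies of v or v and u, so its second smallest letter lies below
    -- β.
    have ha1 : a 1 < β := by
      rcases hu with hu | ⟨u, hus, huβ, huC⟩
      · rw [← hm1v, ← hac] at hu
        obtain ⟨i, j, hij, _, _, hj⟩ := exists_eq_of_two_le_content hu
        have : a 1 ≤ a j := ha (by omega)
        omega
      · have huv := Finset.mem_erase.1 hus
        have hvu := hmin _ huv.2
        have : 0 < content p a u := by
          rw [hac, hm1x u huβ.ne]
          have := Nat.one_le_iff_ne_zero.2 (Finsupp.mem_support_iff.1 huv.2)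
          split_ifs with hx
          · rcases huC with h | h
            · exact absurd hx h
            · omega
          · omega
        obtain ⟨i, _, hi⟩ := content_apply_pos.1 this
        have hi0 : i ≠ 0 := by
          rintro rfl
          have := huv.1
          omega
        have : a 1 ≤ a i := ha (by omega)
        omega
    have hbmem : ∀ i < C.card, b i ∈ C := by
      intro i hi
      have : 0 < content C.card b (b i) := content_apply_pos.2 ⟨i, hi, rfl⟩
      rw [hbc, indicator_apply] at this
      by_contra h
      simp [h] at this
    have hCmem : ∀ x, x ∈ C ↔ ∃ i < C.card, b i = x := by
      intro x
      have : x ∈ C ↔ 0 < content C.card b x := by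
        rw [hbc, indicator_apply]; split_ifs <;> simp_all
      rw [this, content_apply_pos]
    have hab : ∀ i < C.card, a 0 < b i := by
      intro i hi
      have h1 := Finset.mem_erase.1 (hCs (hbmem i hi))
      have := hmin _ h1.2
      have := h1.1
      omega
    have hbβ : b 0 ≤ β := by
      obtain ⟨i, hi, rfl⟩ := (hCmem c).1 hcC
      rcases Nat.eq_zero_or_pos i with rfl | h
      · exact hcβ
      · exact (hb 0 i h hi).le.trans hcβ
    let T : SemistandardYoungTableau μ :=
      { entry := fun i j => if (i, j) ∈ μ then
          (if i = 0 then a j else if j = 0 then b (i - 1) else β) else 0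
        row_weak' := by
          intro i j1 j2 hj hc
          have hc' : (i, j1) ∈ μ := μ.up_left_mem le_rfl hj.le hc
          rw [if_pos hc, if_pos hc']
          rcases (hμ _ _).1 hc with ⟨rfl, h⟩ | ⟨h1, h2, rfl⟩ | ⟨rfl, rfl⟩
          · simpa using ha hj.le
          · omega
          · obtain rfl : j1 = 0 := by omega
            simpa using hbβ
        col_strict' := by
          intro i1 i2 j hi hc
          have hc' : (i1, j) ∈ μ := μ.up_left_mem hi.le le_rfl hc
          rw [if_pos hc, if_pos hc']
          rcases (hμ _ _).1 hc with ⟨rfl, h⟩ | ⟨h1, h2, rfl⟩ | ⟨rfl, rfl⟩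
          · omega
          · rw [if_neg (show i2 ≠ 0 by omega), if_pos rfl, if_pos rfl]
            split_ifs with h
            · exact hab _ (by omega)
            · exact hb _ _ (by omega) (by omega)
          · obtain rfl : i1 = 0 := by omega
            simpa using ha1
        zeros' := fun hc => if_neg hc }
    have hT : ∀ i j, T i j = if (i, j) ∈ μ then
          (if i = 0 then a j else if j = 0 then b (i - 1) else β) else 0 := fun _ _ => rfl
    have hT0 : ∀ j < p, T 0 j = a j := fun j hj => by
      rw [hT, if_pos (harm j hj), if_pos rfl]
    have hT1 : ∀ i < C.card, T (i + 1) 0 = b i := fun i hi => by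
      rw [hT, if_pos (hleg _ (by omega) (by omega)), if_neg (by omega), if_pos rfl,
        Nat.add_sub_cancel]
    have hT11 : T 1 1 = β := by
      rw [hT, if_pos h11, if_neg (by omega), if_neg (by omega)]
    refine ⟨⟨T, ?_⟩, ?_⟩
    · rw [weight_nearHook hμ, content_congr hT0, content_congr hT1, hac, hbc, hT11, add_assoc,
        hsplit]
    · refine Subtype.ext (Prod.ext ?_ hT11)
      ext x
      simp only [legSet, Finset.mem_image, Finset.mem_range]
      rw [hCmem]
      exact exists_congr fun i => and_congr_right fun hi => by rw [hT1 i hi]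

/-! ### Counting the leg pairs over all leg lengths -/

/-- Only C = s can fail the condition, and it does so exactly when no variable is repeated. -/
theorem card_filter_powerset_and_or {s : Finset ℕ} (m : ℕ → ℕ) (e : Prop) [Decidable e] :
    ((s.powerset.filter fun C => e ∨ ∃ u ∈ s, u ∉ C ∨ 2 ≤ m u).card : ℤ) =
      2 ^ s.card - if ¬e ∧ ∀ u ∈ s, m u < 2 then 1 else 0 := by
  have h := Finset.card_filter_add_card_filter_not (s := s.powerset)
    (fun C => e ∨ ∃ u ∈ s, u ∉ C ∨ 2 ≤ m u)
  have hneg : (s.powerset.filter fun C => ¬(e ∨ ∃ u ∈ s, u ∉ C ∨ 2 ≤ m u)) =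
      if ¬e ∧ ∀ u ∈ s, m u < 2 then {s} else ∅ := by
    ext C
    rw [Finset.mem_filter, Finset.mem_powerset]
    push Not
    constructor
    · rintro ⟨hC, he, hu⟩
      rw [if_pos ⟨he, fun u hus => (hu u hus).2⟩, Finset.mem_singleton]
      exact Finset.Subset.antisymm hC fun u hus => (hu u hus).1
    · split_ifs with hs
      · rw [Finset.mem_singleton]
        rintro rfl
        exact ⟨subset_rfl, hs.1, fun u hu => ⟨hu, hs.2 u hu⟩⟩
      · simp
  rw [hneg, Finset.card_powerset] at h
  have h' : (((s.powerset.filter fun C => e ∨ ∃ u ∈ s, u ∉ C ∨ 2 ≤ m u).card +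
    (if ¬e ∧ ∀ u ∈ s, m u < 2 then {s} else ∅ : Finset (Finset ℕ)).card : ℕ) : ℤ) =
      ((2 ^ s.card : ℕ) : ℤ) := by rw [h]
  push_cast at h'
  split_ifs at h' ⊢ <;> simp at h' ⊢ <;> linarith

/-- Pairs with b ≠ x do not notice whether x is in the leg, which gives the factor 2. Pairs with b =
x contribute the second term if x is outside the leg, and the third if it is inside, where x itself
witnesses the existence of a leg entry at most b but must occur twice. -/
theorem card_legPairs_insert (m : ℕ → ℕ) (e : Prop) [Decidable e] {s : Finset ℕ} {x : ℕ}
    (hx : ∀ u ∈ s, u < x) :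
    (legPairs m e (insert x s)).card = 2 * (legPairs m e s).card +
      (s.powerset.filter fun C => C.Nonempty ∧ (e ∨ ∃ u ∈ s, u ∉ C ∨ 2 ≤ m u)).card +
      if 2 ≤ m x then (s.powerset.filter fun C => e ∨ ∃ u ∈ s, u ∉ C ∨ 2 ≤ m u).card else 0 := by
  have hxs : x ∉ s := fun h => lt_irrefl _ (hx x h)
  have hu : ∀ (C : Finset ℕ), ∀ b ≤ x, (∃ u ∈ insert x s, u < b ∧ (u ∉ C ∨ 2 ≤ m u)) ↔
      ∃ u ∈ s, u < b ∧ (u ∉ C ∨ 2 ≤ m u) := by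
    intro C b hb
    constructor
    · rintro ⟨u, hus, hub, h⟩
      rcases Finset.mem_insert.1 hus with rfl | hus
      · omega
      · exact ⟨u, hus, hub, h⟩
    · rintro ⟨u, hus, h⟩
      exact ⟨u, Finset.mem_insert_of_mem hus, h⟩
  have hu' : ∀ (C : Finset ℕ), ∀ b ≤ x, (∃ u ∈ s, u < b ∧ (u ∉ insert x C ∨ 2 ≤ m u)) ↔
      ∃ u ∈ s, u < b ∧ (u ∉ C ∨ 2 ≤ m u) := by
    intro C b hb
    refine exists_congr fun u => and_congr_right fun hus => and_congr_right fun _ => ?_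
    rw [Finset.mem_insert]
    have := hx u hus
    have : u ≠ x := by omega
    tauto
  have hux : ∀ C : Finset ℕ, (∃ u ∈ s, u < x ∧ (u ∉ C ∨ 2 ≤ m u)) ↔
      ∃ u ∈ s, u ∉ C ∨ 2 ≤ m u := fun C =>
    exists_congr fun u => and_congr_right fun hus => by simp [hx u hus]
  rw [legPairs, Finset.card_filter, Finset.sum_product, Finset.sum_powerset_insert hxs]
  rw [legPairs, Finset.card_filter, Finset.sum_product]
  rw [Finset.card_filter, Finset.card_filter, two_mul]
  have h1 : ∀ C ∈ s.powerset, (∑ b ∈ insert x s, if (b ∉ C ∨ 2 ≤ m b) ∧ (∃ c ∈ C, c ≤ b) ∧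
      (e ∨ ∃ u ∈ insert x s, u < b ∧ (u ∉ C ∨ 2 ≤ m u)) then 1 else 0) =
      (if C.Nonempty ∧ (e ∨ ∃ u ∈ s, u ∉ C ∨ 2 ≤ m u) then 1 else 0) +
      ∑ b ∈ s, if (b ∉ C ∨ 2 ≤ m b) ∧ (∃ c ∈ C, c ≤ b) ∧
      (e ∨ ∃ u ∈ s, u < b ∧ (u ∉ C ∨ 2 ≤ m u)) then 1 else 0 := by
    intro C hC
    rw [Finset.mem_powerset] at hC
    rw [Finset.sum_insert hxs]
    congr 1
    · refine if_congr ?_ rfl rfl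
      rw [hu C x le_rfl, hux]
      have h2 : (∃ c ∈ C, c ≤ x) ↔ C.Nonempty :=
        ⟨fun ⟨c, hc, _⟩ => ⟨c, hc⟩, fun ⟨c, hc⟩ => ⟨c, hc, (hx c (hC hc)).le⟩⟩
      have h3 : x ∉ C := fun h => hxs (hC h)
      rw [h2]
      exact ⟨fun h => h.2, fun h => ⟨Or.inl h3, h⟩⟩
    · exact Finset.sum_congr rfl fun b hb => if_congr (by rw [hu C b (hx b hb).le]) rfl rfl
  have h2 : ∀ C ∈ s.powerset, (∑ b ∈ insert x s, if (b ∉ insert x C ∨ 2 ≤ m b) ∧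
      (∃ c ∈ insert x C, c ≤ b) ∧
      (e ∨ ∃ u ∈ insert x s, u < b ∧ (u ∉ insert x C ∨ 2 ≤ m u)) then 1 else 0) =
      (if 2 ≤ m x then if e ∨ ∃ u ∈ s, u ∉ C ∨ 2 ≤ m u then 1 else 0 else 0) +
      ∑ b ∈ s, if (b ∉ C ∨ 2 ≤ m b) ∧ (∃ c ∈ C, c ≤ b) ∧
      (e ∨ ∃ u ∈ s, u < b ∧ (u ∉ C ∨ 2 ≤ m u)) then 1 else 0 := by
    intro C hC
    rw [Finset.mem_powerset] at hC
    rw [Finset.sum_insert hxs]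
    congr 1
    · rw [← ite_and]
      refine if_congr ?_ rfl rfl
      rw [hu _ x le_rfl, hu' C x le_rfl, hux]
      have h2 : ∃ c ∈ insert x C, c ≤ x := ⟨x, Finset.mem_insert_self _ _, le_rfl⟩
      have h3 : x ∈ insert x C := Finset.mem_insert_self _ _
      exact ⟨fun h => ⟨h.1.resolve_left (not_not.2 h3), h.2.2⟩, fun h => ⟨Or.inr h.1, h2, h.2⟩⟩
    · refine Finset.sum_congr rfl fun b hb => if_congr ?_ rfl rfl
      have hbx := hx b hb
      rw [hu _ b hbx.le, hu' C b hbx.le]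
      have h3 : (∃ c ∈ insert x C, c ≤ b) ↔ ∃ c ∈ C, c ≤ b := by
        simp only [Finset.mem_insert, exists_eq_or_imp]
        constructor
        · rintro (h | h)
          · omega
          · exact h
        · exact Or.inr
      have h4 : b ∈ insert x C ↔ b ∈ C := by
        rw [Finset.mem_insert]
        have : b ≠ x := hbx.ne
        tauto
      rw [h3, h4]
  rw [Finset.sum_congr rfl h1, Finset.sum_congr rfl h2, Finset.sum_add_distrib,
    Finset.sum_add_distrib]
  split_ifs
  · ring
  · simp; ring

/-- The proposition `e` stands for a repeated minimal variable and is kept abstract, so that the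
induction runs over the other variables only. The formula fails for empty s without `e`, which
corresponds to a monomial of degree 1. -/
theorem card_legPairs (m : ℕ → ℕ) (e : Prop) [Decidable e] (s : Finset ℕ) (hs : s.Nonempty ∨ e) :
    (2 * (legPairs m e s).card : ℤ) =
      2 ^ s.card * (s.card + 1 + ((if e then 1 else 0) + (s.filter fun u => 2 ≤ m u).card) - 4) +
        2 + 2 * if ¬e ∧ ∀ u ∈ s, m u < 2 then 1 else 0 := by
  induction s using Finset.induction_on_max with
  | empty =>
    have he : e := by simpa using hs
    simp [legPairs, he]
  | insert x s hx ih =>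
    have hxs : x ∉ s := fun h => lt_irrefl _ (hx x h)
    have hG := card_filter_powerset_and_or (s := s) m e
    rw [card_legPairs_insert m e hx, Finset.card_insert_of_notMem hxs, Finset.filter_insert]
    by_cases hse : s.Nonempty ∨ e
    · have ih := ih hse
      -- The two families of legs differ by C = ∅ alone, which satisfies the second condition
      -- because s is nonempty or `e` holds.
      have hA : (s.powerset.filter fun C => e ∨ ∃ u ∈ s, u ∉ C ∨ 2 ≤ m u).card =
          (s.powerset.filter fun C => C.Nonempty ∧ (e ∨ ∃ u ∈ s, u ∉ C ∨ 2 ≤ m u)).card + 1 := by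
        have : (s.powerset.filter fun C => e ∨ ∃ u ∈ s, u ∉ C ∨ 2 ≤ m u) =
            insert ∅ (s.powerset.filter fun C => C.Nonempty ∧
              (e ∨ ∃ u ∈ s, u ∉ C ∨ 2 ≤ m u)) := by
          ext C
          simp only [Finset.mem_filter, Finset.mem_powerset, Finset.mem_insert]
          rcases C.eq_empty_or_nonempty with rfl | hC
          · simp only [Finset.empty_subset, true_and, true_or, iff_true]
            rcases hse with ⟨u, hu⟩ | he
            · exact Or.inr ⟨u, hu, Or.inl (Finset.notMem_empty u)⟩
            · exact Or.inl he
          · simp [hC, hC.ne_empty]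
        rw [this, Finset.card_insert_of_notMem]
        simp
      rw [hA] at hG ⊢
      generalize (s.powerset.filter fun C => C.Nonempty ∧
        (e ∨ ∃ u ∈ s, u ∉ C ∨ 2 ≤ m u)).card = A at *
      generalize (legPairs m e s).card = N at *
      have hsq : (¬e ∧ ∀ u ∈ insert x s, m u < 2) ↔ (¬e ∧ ∀ u ∈ s, m u < 2) ∧ m x < 2 := by
        simp only [Finset.mem_insert, forall_eq_or_imp]
        tauto
      rw [if_congr hsq rfl rfl]
      push_cast at hG ⊢
      rw [pow_succ]
      by_cases hmx : 2 ≤ m x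
      · have hmx' : ¬ m x < 2 := by omega
        simp only [hmx, hmx', if_true, and_false, if_false]
        rw [Finset.card_insert_of_notMem (fun h => hxs (Finset.mem_of_mem_filter _ h))]
        push_cast
        linear_combination 2 * ih + 4 * hG
      · have hmx' : m x < 2 := by omega
        simp only [hmx, hmx', if_false, and_true]
        linear_combination 2 * ih + 2 * hG
    · have hs0 : s = ∅ := by
        rw [← Finset.not_nonempty_iff_eq_empty]; tauto
      have he : ¬e := by tauto
      subst hs0
      by_cases hmx : 2 ≤ m x
      · simp [legPairs, he, hmx]
        omega
      · have hmx' : m x < 2 := by omega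
        simp [legPairs, he, hmx, Nat.le_of_lt_succ hmx']

/-! ### The Schur expansion -/

theorem isHook_diagram {p q : ℕ} (hp : 1 ≤ p) :
    IsHook (diagram (p ::ₘ Multiset.replicate q 1)) p q := mem_diagram_hook hp

theorem isNearHook_diagram {p q : ℕ} (hp : 2 ≤ p) (hq : 1 ≤ q) :
    IsNearHook (diagram (p ::ₘ 2 ::ₘ Multiset.replicate (q - 1) 1)) p q :=
  mem_diagram_nearHook hp hq

theorem schur_hook_eq_zero {p q : ℕ} (hp : 1 ≤ p) {m : ℕ →₀ ℕ} (hm : m.degree ≠ p + q) :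
    schur (p ::ₘ Multiset.replicate q 1) m = 0 := by
  unfold schur
  rw [Nat.card_eq_zero.2 (Or.inl ⟨fun T => hm ?_⟩), Nat.cast_zero]
  rw [← T.2, weight_hook (isHook_diagram hp), map_add, degree_content, degree_content]

theorem schur_nearHook_eq_zero {p q : ℕ} (hp : 2 ≤ p) (hq : 1 ≤ q) {m : ℕ →₀ ℕ}
    (hm : m.degree ≠ p + q + 1) :
    schur (p ::ₘ 2 ::ₘ Multiset.replicate (q - 1) 1) m = 0 := by
  unfold schur
  rw [Nat.card_eq_zero.2 (Or.inl ⟨fun T => hm ?_⟩), Nat.cast_zero]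
  rw [← T.2, weight_nearHook (isNearHook_diagram hp hq), map_add, map_add, degree_content,
    degree_content, Finsupp.degree_single]

theorem exists_min_support {m : ℕ →₀ ℕ} (hm : m.degree ≠ 0) :
    ∃ v ∈ m.support, ∀ x ∈ m.support, v ≤ x := by
  have hne : m.support.Nonempty := by
    rw [Finsupp.support_nonempty_iff]
    rintro rfl
    simp at hm
  exact ⟨m.support.min' hne, Finset.min'_mem _ _, fun x hx => Finset.min'_le _ x hx⟩

theorem schur_hook_apply {p q : ℕ} (hp : 1 ≤ p) {m : ℕ →₀ ℕ} (hm : m.degree = p + q) :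
    schur (p ::ₘ Multiset.replicate q 1) m = (numVars m - 1).choose q := by
  obtain ⟨v, hv, hmin⟩ := exists_min_support (m := m) (by omega)
  unfold schur
  rw [card_tableaux_hook hp (isHook_diagram hp) hm hv hmin, Finset.card_powersetCard,
    Finset.card_erase_of_mem hv, numVars]

theorem schur_nearHook_apply {p q : ℕ} (hp : 2 ≤ p) (hq : 1 ≤ q) {m : ℕ →₀ ℕ}
    (hm : m.degree = p + q + 1) {v : ℕ} (hv : v ∈ m.support) (hmin : ∀ x ∈ m.support, v ≤ x) :
    schur (p ::ₘ 2 ::ₘ Multiset.replicate (q - 1) 1) m =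
      ((legPairs m (2 ≤ m v) (m.support.erase v)).filter fun c => c.1.card = q).card := by
  unfold schur
  rw [card_tableaux_nearHook hp hq (isNearHook_diagram hp hq) hm hv hmin]

theorem degree_le_of_le {m m' : ℕ →₀ ℕ} (h : m ≤ m') : m.degree ≤ m'.degree := by
  rw [← tsub_add_cancel_of_le h, map_add]
  omega

/-- Besides the leg, the monomial must provide b, v and a second arm letter. So leg lengths lie
between 1 and n - 3, and summing over near-hook shapes accounts for every pair. -/
theorem card_leg_of_mem_legPairs {m : ℕ →₀ ℕ} {v : ℕ} (hv : v ∈ m.support)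
    {c : Finset ℕ × ℕ} (hc : c ∈ legPairs m (2 ≤ m v) (m.support.erase v)) :
    1 ≤ c.1.card ∧ c.1.card + 3 ≤ m.degree := by
  obtain ⟨C, b⟩ := c
  obtain ⟨⟨hCs, hb⟩, hbC, ⟨c, hcC, _⟩, hu⟩ := mem_legPairs.1 hc
  refine ⟨Finset.card_pos.2 ⟨c, hcC⟩, ?_⟩
  have hpos : ∀ x ∈ m.support.erase v, 1 ≤ m x := fun x hx =>
    Nat.one_le_iff_ne_zero.2 (Finsupp.mem_support_iff.1 (Finset.mem_of_mem_erase hx))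
  have hvpos : 1 ≤ m v := Nat.one_le_iff_ne_zero.2 (Finsupp.mem_support_iff.1 hv)
  have hvC : v ∉ C := fun h => by simpa using hCs h
  have hbv := Finset.ne_of_mem_erase hb
  have hb1 := hpos b hb
  -- Here u is the second arm letter, equal to v when v is repeated.
  have key : ∃ u, indicator C + Finsupp.single b 1 + Finsupp.single v 1 + Finsupp.single u 1 ≤ m := by
    rcases hu with hu | ⟨u, hus, hub, huC⟩
    · refine ⟨v, fun x => ?_⟩
      have h1 : x ∈ C → 1 ≤ m x := fun hx => hpos x (hCs hx)
      simp only [Finsupp.add_apply, indicator_apply, Finsupp.single_apply]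
      by_cases h2 : b = x
      · subst h2
        by_cases h3 : b ∈ C
        · have := hbC.resolve_left (not_not.2 h3)
          simp [h3, hbv.symm]; omega
        · simp [h3, hbv.symm]; omega
      · by_cases h3 : v = x
        · subst h3
          simp [h2, hvC]; omega
        · by_cases h4 : x ∈ C
          · simp [h2, h3, h4]; have := h1 h4; omega
          · simp [h2, h3, h4]
    · refine ⟨u, fun x => ?_⟩
      have h1 : x ∈ C → 1 ≤ m x := fun hx => hpos x (hCs hx)
      have huv := Finset.ne_of_mem_erase hus
      have hu1 := hpos u hus
      simp only [Finsupp.add_apply, indicator_apply, Finsupp.single_apply]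
      by_cases h2 : b = x
      · subst h2
        by_cases h3 : b ∈ C
        · have := hbC.resolve_left (not_not.2 h3)
          simp [h3, hbv.symm, hub.ne]; omega
        · simp [h3, hbv.symm, hub.ne]; omega
      · by_cases h3 : v = x
        · subst h3
          simp [h2, hvC, huv]; omega
        · by_cases h4 : u = x
          · subst h4
            by_cases h5 : u ∈ C
            · have := huC.resolve_left (not_not.2 h5)
              simp [h2, h3, h5]; omega
            · simp [h2, h3, h5]; omega
          · by_cases h5 : x ∈ C
            · simp [h2, h3, h4, h5]; have := h1 h5; omega
            · simp [h2, h3, h4, h5]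
  obtain ⟨u, hu⟩ := key
  have := degree_le_of_le hu
  simp only [map_add, degree_indicator, Finsupp.degree_single] at this
  exact this

theorem indicator_support_le (m : ℕ →₀ ℕ) : indicator m.support ≤ m := by
  intro x
  rw [indicator_apply]
  split_ifs with h
  · exact Nat.one_le_iff_ne_zero.2 (Finsupp.mem_support_iff.1 h)
  · exact Nat.zero_le _

theorem numVars_le_degree (m : ℕ →₀ ℕ) : numVars m ≤ m.degree := by
  rw [numVars, ← degree_indicator]
  exact degree_le_of_le (indicator_support_le m)

theorem numVars_eq_degree_iff (m : ℕ →₀ ℕ) :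
    numVars m = m.degree ↔ ∀ x ∈ m.support, m x < 2 := by
  constructor
  · intro h x hx
    by_contra h2
    have hle : indicator m.support + Finsupp.single x 1 ≤ m := by
      intro y
      rw [Finsupp.add_apply]
      by_cases hy : y = x
      · subst hy
        rw [indicator_apply, if_pos hx, Finsupp.single_eq_same]
        omega
      · rw [Finsupp.single_eq_of_ne hy, add_zero]
        exact indicator_support_le m y
    have := degree_le_of_le hle
    rw [map_add, degree_indicator, Finsupp.degree_single, ← h, numVars] at this
    omega
  · intro h
    rw [numVars, ← degree_indicator]
    congr 1
    ext x
    rw [indicator_apply]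
    split_ifs with hx
    · have := h x hx
      have := Nat.pos_of_ne_zero (Finsupp.mem_support_iff.1 hx)
      omega
    · exact (Finsupp.notMem_support_iff.1 hx).symm

/-- The right-hand side of the Schur expansion. -/
noncomputable def schurExpansion (n : ℕ) : MvPowerSeries ℕ ℚ :=
  schur {n} + schur (Multiset.replicate n 1)
    + ∑ k ∈ Finset.Icc 2 (n - 2), schur ((n - k) ::ₘ 2 ::ₘ Multiset.replicate (k - 2) 1)
    + 2 * ∑ k ∈ Finset.Icc 1 (n - 2), schur ((n - k) ::ₘ Multiset.replicate k 1)

theorem schurExpansion_apply {n : ℕ} (hn : 2 ≤ n) (m : ℕ →₀ ℕ) :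
    schurExpansion n m =
      schur ((n - 0) ::ₘ Multiset.replicate 0 1) m +
      schur ((n - (n - 1)) ::ₘ Multiset.replicate (n - 1) 1) m +
      ∑ q ∈ Finset.Icc 1 (n - 3), schur ((n - 1 - q) ::ₘ 2 ::ₘ Multiset.replicate (q - 1) 1) m +
      2 * ∑ k ∈ Finset.Icc 1 (n - 2), schur ((n - k) ::ₘ Multiset.replicate k 1) m := by
  have h1 : ({n} : Multiset ℕ) = (n - 0) ::ₘ Multiset.replicate 0 1 := rfl
  have h2 : Multiset.replicate n 1 = (n - (n - 1)) ::ₘ Multiset.replicate (n - 1) 1 := by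
    rw [show n - (n - 1) = 1 by omega, ← Multiset.replicate_succ]
    congr 1; omega
  -- The leg length is q = k - 1, since the part 2 also occupies a row of the leg.
  have h3 : ∑ q ∈ Finset.Icc 1 (n - 3), schur ((n - 1 - q) ::ₘ 2 ::ₘ Multiset.replicate (q - 1) 1) m
      = ∑ k ∈ Finset.Icc 2 (n - 2),
        schur ((n - k) ::ₘ 2 ::ₘ Multiset.replicate (k - 2) 1) m := by
    refine Finset.sum_bij' (fun q _ => q + 1) (fun k _ => k - 1) ?_ ?_ ?_ ?_ ?_
    · intro q hq; simp only [Finset.mem_Icc] at hq ⊢; omega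
    · intro q hq; simp only [Finset.mem_Icc] at hq ⊢; omega
    · intro q hq; simp only [Finset.mem_Icc] at hq ⊢; omega
    · intro q hq; simp only [Finset.mem_Icc] at hq ⊢; omega
    · intro q hq
      rw [show n - 1 - q = n - (q + 1) by omega, show q - 1 = q + 1 - 2 by omega]
  have h4 : MvPowerSeries.coeff m (schurExpansion n) =
      MvPowerSeries.coeff m (schur {n}) + MvPowerSeries.coeff m (schur (Multiset.replicate n 1)) +
      ∑ k ∈ Finset.Icc 2 (n - 2), MvPowerSeries.coeff m
        (schur ((n - k) ::ₘ 2 ::ₘ Multiset.replicate (k - 2) 1)) +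
      2 * ∑ k ∈ Finset.Icc 1 (n - 2), MvPowerSeries.coeff m
        (schur ((n - k) ::ₘ Multiset.replicate k 1)) := by
    rw [schurExpansion, two_mul, two_mul]
    simp only [map_add, map_sum]
  rw [h3, ← h1, ← h2]
  exact h4

theorem schurExpansion_eq_zero {n : ℕ} (hn : 2 ≤ n) {m : ℕ →₀ ℕ} (hm : m.degree ≠ n) :
    schurExpansion n m = 0 := by
  rw [schurExpansion_apply hn, schur_hook_eq_zero (by omega) (by omega),
    schur_hook_eq_zero (by omega) (by omega), Finset.sum_eq_zero, Finset.sum_eq_zero]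
  · simp
  · intro k hk
    rw [Finset.mem_Icc] at hk
    exact schur_hook_eq_zero (by omega) (by omega)
  · intro q hq
    rw [Finset.mem_Icc] at hq
    exact schur_nearHook_eq_zero (by omega) (by omega) (by omega)

/-- The full binomial sum, with the terms k = 0 and k = n - 1 split off; these belong to the shapes
of one row and one column. -/
theorem sum_choose_Icc {n l : ℕ} (hn : 2 ≤ n) (hl : l ≤ n - 1) :
    (∑ k ∈ Finset.Icc 1 (n - 2), (l.choose k : ℚ)) + 1 + (if l = n - 1 then 1 else 0) = 2 ^ l := by
  have h1 : ∑ k ∈ Finset.range n, l.choose k = 2 ^ l := by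
    rw [← Nat.sum_range_choose]
    symm
    refine Finset.sum_subset (Finset.range_subset_range.2 (by omega)) fun k _ hk => ?_
    rw [Finset.mem_range] at hk
    exact Nat.choose_eq_zero_of_lt (by omega)
  have h2 : Finset.range n = insert 0 (insert (n - 1) (Finset.Icc 1 (n - 2))) := by
    ext k
    simp only [Finset.mem_range, Finset.mem_insert, Finset.mem_Icc]
    omega
  rw [h2, Finset.sum_insert, Finset.sum_insert] at h1
  · have h3 : l.choose (n - 1) = if l = n - 1 then 1 else 0 := by
      split_ifs with h
      · rw [h, Nat.choose_self]
      · exact Nat.choose_eq_zero_of_lt (by omega)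
    rw [h3, Nat.choose_zero_right] at h1
    have h4 := congrArg (Nat.cast : ℕ → ℚ) h1
    push_cast at h4
    linarith
  · simp; omega
  · simp; omega

theorem schurExpansion_apply_of_degree {n : ℕ} (hn : 2 ≤ n) {m : ℕ →₀ ℕ} (hm : m.degree = n) :
    4 * schurExpansion n m = 2 ^ numVars m * (numVars m + numSquares m) := by
  obtain ⟨v, hv, hmin⟩ := exists_min_support (m := m) (by omega)
  set s := m.support.erase v with hs
  have hcard : numVars m = s.card + 1 := (Finset.card_erase_add_one hv).symm
  have hle := numVars_le_degree m
  have hsupp : m.support = insert v s := (Finset.insert_erase hv).symm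
  have hsq : numSquares m = (if 2 ≤ m v then 1 else 0) + (s.filter fun u => 2 ≤ m u).card := by
    rw [numSquares, hsupp, Finset.filter_insert]
    split_ifs with h
    · rw [Finset.card_insert_of_notMem (by simp [hs]), add_comm]
    · rw [zero_add]
  have hfree : (¬2 ≤ m v ∧ ∀ u ∈ s, m u < 2) ↔ s.card = n - 1 := by
    have := numVars_eq_degree_iff m
    rw [hsupp] at this
    simp only [Finset.mem_insert, forall_eq_or_imp] at this
    rw [not_le, ← this]
    omega
  -- A monomial in one variable of degree at least 2 has that variable repeated.
  have hse : s.Nonempty ∨ 2 ≤ m v := by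
    by_contra hcon
    rw [not_or, Finset.not_nonempty_iff_eq_empty] at hcon
    have := hfree.1 ⟨hcon.2, by simp [hcon.1]⟩
    rw [hcon.1] at this
    simp at this
    omega
  have hnear : ∑ q ∈ Finset.Icc 1 (n - 3),
      schur ((n - 1 - q) ::ₘ 2 ::ₘ Multiset.replicate (q - 1) 1) m =
      (legPairs m (2 ≤ m v) s).card := by
    rw [Finset.card_eq_sum_card_fiberwise (f := fun c => c.1.card) (t := Finset.Icc 1 (n - 3))]
    · push_cast
      refine Finset.sum_congr rfl fun q hq => ?_
      rw [Finset.mem_Icc] at hq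
      exact schur_nearHook_apply (by omega) (by omega) (by omega) hv hmin
    · intro c hc
      have := card_leg_of_mem_legPairs hv (Finset.mem_coe.1 hc)
      rw [Finset.coe_Icc]
      change 1 ≤ c.1.card ∧ c.1.card ≤ n - 3
      omega
  have hhook : ∀ k ≤ n - 1, schur ((n - k) ::ₘ Multiset.replicate k 1) m = (s.card.choose k : ℚ) := by
    intro k hk
    rw [schur_hook_apply (by omega) (by omega), hcard, Nat.add_sub_cancel]
  have hlast : (s.card.choose (n - 1) : ℚ) = if s.card = n - 1 then 1 else 0 := by
    split_ifs with h
    · rw [h, Nat.choose_self, Nat.cast_one]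
    · rw [Nat.choose_eq_zero_of_lt (by omega), Nat.cast_zero]
  have hL := congrArg (Int.cast : ℤ → ℚ) (card_legPairs m (2 ≤ m v) s hse)
  have hsum := sum_choose_Icc hn (l := s.card) (by omega)
  rw [schurExpansion_apply hn, hhook 0 (by omega), hhook (n - 1) le_rfl, hnear, hlast,
    Finset.sum_congr rfl fun k hk => hhook k (by rw [Finset.mem_Icc] at hk; omega),
    Nat.choose_zero_right, hcard, hsq]
  rw [if_congr hfree rfl rfl] at hL
  push_cast at hL ⊢
  rw [pow_succ]
  -- Let l = v - 1, let N be the number of leg pairs, and let δ be 1 for squarefree monomials and 0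
  -- otherwise. The expansion gives 1 + δ + N + 2 (2^l - 1 - δ), and 2N = 2^l (v + s - 4) + 2 + 2δ;
  -- all but 2^l (v + s) / 2 cancels.
  linear_combination 2 * hL + 8 * hsum

theorem quasisymmetricFunction_arcPerms {n : ℕ} (hn : 1 ≤ n) :
    quasisymmetricFunction (arcPerms (n + 1)) = schurExpansion (n + 1) := by
  funext m
  by_cases hm : m.degree = n + 1
  · have h1 := coeff_quasisymmetricFunction_arcPerms hn hm
    have h2 := schurExpansion_apply_of_degree (by omega) hm
    linarith
  · rw [quasisymmetricFunction_eq_zero _ hm, schurExpansion_eq_zero (by omega) hm]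

/-! ### Schur positivity and the case n = 1 -/

theorem isSchurPositive_schur {n : ℕ} {l : Multiset ℕ} (hpos : ∀ i ∈ l, 0 < i) (hsum : l.sum = n) :
    IsSchurPositive n (schur l) := by
  classical
  refine ⟨fun p => if p.parts = l then 1 else 0, fun p => by dsimp only; split_ifs <;> simp, ?_⟩
  rw [Finset.sum_eq_single (⟨l, fun {i} hi => hpos i hi, hsum⟩ : n.Partition)]
  · simp
  · intro p _ hp
    dsimp only
    rw [if_neg fun h => hp (Nat.Partition.ext h), zero_smul]
  · simp

theorem IsSchurPositive.add {n : ℕ} {f g : MvPowerSeries ℕ ℚ} (hf : IsSchurPositive n f)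
    (hg : IsSchurPositive n g) : IsSchurPositive n (f + g) := by
  obtain ⟨c, hc, rfl⟩ := hf
  obtain ⟨d, hd, rfl⟩ := hg
  exact ⟨c + d, fun p => add_nonneg (hc p) (hd p), by
    simp [add_smul, Finset.sum_add_distrib]⟩

theorem isSchurPositive_sum {n : ℕ} (t : Finset ℕ) (f : ℕ → MvPowerSeries ℕ ℚ)
    (hf : ∀ k ∈ t, IsSchurPositive n (f k)) : IsSchurPositive n (∑ k ∈ t, f k) :=
  Finset.sum_induction f (IsSchurPositive n) (fun _ _ => IsSchurPositive.add)
    ⟨0, fun _ => le_rfl, by simp⟩ hf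

theorem isSchurPositive_schurExpansion {n : ℕ} (hn : 1 ≤ n) :
    IsSchurPositive n (schurExpansion n) := by
  have hhook : IsSchurPositive n
      (∑ k ∈ Finset.Icc 1 (n - 2), schur ((n - k) ::ₘ Multiset.replicate k 1)) := by
    refine isSchurPositive_sum _ _ fun k hk => ?_
    rw [Finset.mem_Icc] at hk
    refine isSchurPositive_schur ?_ ?_
    · intro i hi
      rw [Multiset.mem_cons] at hi
      rcases hi with rfl | hi
      · omega
      · rw [Multiset.eq_of_mem_replicate hi]; omega
    · simp; omega
  rw [schurExpansion, two_mul]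
  refine (((isSchurPositive_schur ?_ ?_).add (isSchurPositive_schur ?_ ?_)).add
    (isSchurPositive_sum _ _ fun k hk => ?_)).add (hhook.add hhook)
  · simp; omega
  · simp
  · intro i hi
    rw [Multiset.eq_of_mem_replicate hi]; omega
  · simp
  · rw [Finset.mem_Icc] at hk
    refine isSchurPositive_schur ?_ ?_
    · intro i hi
      rw [Multiset.mem_cons, Multiset.mem_cons] at hi
      rcases hi with rfl | rfl | hi
      · omega
      · omega
      · rw [Multiset.eq_of_mem_replicate hi]; omega
    · simp; omega

/-- Degree 1 needs separate treatment: the shapes of one row and one column coincide there, and the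
formula 2^(v-2) (v + s) would give 1/2. -/
theorem quasisymmetricFunction_arcPerms_one :
    quasisymmetricFunction (arcPerms 1) = schur {1} := by
  have harc : arcPerms 1 = {1} := by
    ext π
    simp [arcPerms, isArc_fin_one, Subsingleton.elim π 1]
  funext m
  have h1 : ({1} : Multiset ℕ) = 1 ::ₘ Multiset.replicate 0 1 := rfl
  by_cases hm : m.degree = 1
  · obtain ⟨a, ha, hc⟩ := exists_monotone_content m
    rw [h1, schur_hook_apply le_rfl (by omega), quasisymmetricFunction_apply, harc,
      Finset.sum_singleton, ← hc, hm, fundamental_content _ _ ha]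
    rw [if_pos fun j => absurd j.2 (by omega)]
    simp
  · rw [quasisymmetricFunction_eq_zero _ hm, h1, schur_hook_eq_zero le_rfl (by omega)]

theorem isFine_arcPerms_one : IsFine (arcPerms 1) := by
  rw [IsFine, quasisymmetricFunction_arcPerms_one]
  have h1 : ({1} : Multiset ℕ) = 1 ::ₘ Multiset.replicate 0 1 := rfl
  refine ⟨⟨fun m hm => by_contra fun h => hm ?_, fun e m => ?_⟩,
    isSchurPositive_schur (by simp) (by simp)⟩
  · rw [h1]
    exact schur_hook_eq_zero le_rfl h
  · change schur {1} (m.mapDomain e) = schur {1} m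
    have hdeg : (m.mapDomain e).degree = m.degree := by simp
    rw [h1]
    by_cases hm : m.degree = 1
    · rw [schur_hook_apply le_rfl (hdeg.trans hm), schur_hook_apply le_rfl hm]
      simp
    · rw [schur_hook_eq_zero le_rfl (by rwa [hdeg]), schur_hook_eq_zero le_rfl hm]

theorem isFine_arcPerms {n : ℕ} (hn : 1 ≤ n) : IsFine (arcPerms n) := by
  obtain ⟨k, rfl⟩ : ∃ k, n = k + 1 := ⟨n - 1, by omega⟩
  rcases Nat.eq_zero_or_pos k with rfl | hk
  · exact isFine_arcPerms_one
  · refine ⟨isSymmetricFunction_arcPerms hk, ?_⟩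
    rw [quasisymmetricFunction_arcPerms hk]
    exact isSchurPositive_schurExpansion hn

end ArcPerm

theorem proposition5p12 (n : ℕ) (hn : 1 ≤ n) :
    ArcPerm.IsFine (ArcPerm.arcPerms n) ∧
    (2 ≤ n →
      ArcPerm.quasisymmetricFunction (ArcPerm.arcPerms n) =
        ArcPerm.schur {n} + ArcPerm.schur (Multiset.replicate n 1)
        + ∑ k ∈ Finset.Icc 2 (n - 2),
            ArcPerm.schur ((n - k) ::ₘ 2 ::ₘ Multiset.replicate (k - 2) 1)
        + 2 * ∑ k ∈ Finset.Icc 1 (n - 2),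
            ArcPerm.schur ((n - k) ::ₘ Multiset.replicate k 1)) ∧
    (2 ≤ n →
      ArcPerm.multisetProduct (ArcPerm.cyclicPerms n) (ArcPerm.leftUnimodalPerms n) =
        2 • (ArcPerm.arcPerms n).val) := by
  obtain ⟨k, rfl⟩ : ∃ k, n = k + 1 := ⟨n - 1, by omega⟩
  exact ⟨ArcPerm.isFine_arcPerms hn,
    fun h => ArcPerm.quasisymmetricFunction_arcPerms (by omega),
    fun h => ArcPerm.multisetProduct_cyclic_leftUnimodal (by omega)⟩
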